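/- Let $\mathbb F_q$ be a finite field and let $m(x)=x^2+ax+b\in\mathbb F_q[x]$ be a primitive polynomial, i.e. irreducible with a root generating $\mathbb F_{q^2}^*$. Put $F=\mathbb F_q(x)$ and $Q(x)=x^2+\frac ab x+\frac1b$, and let $\sigma$ be the $\mathbb F_q$-automorphism of $F$ with $\sigma(x)=\frac{1}{-bx-a}$ (it has order $q+1$). Let $G\le\langle\sigma\rangle$ be a subgroup of order $n$, and suppose that $n$ is $B$-smooth: $n=\prod_{i=1}^r p_i$ with integers $2\le p_i\le B$. Notation. For $0\le i\le r$ let $G_i=\langle\sigma^{(q+1)/(p_1\cdots p_i)}\rangle$ be the subgroup of $\langle\sigma\rangle$ of order $p_1\cdots p_i$ (so $G_0=\{1\}$ and $G_r=G$), $F_i=F^{G_i}$ and $x_i=\sum_{\tau\in G_i}\tau(x)$; let $y_r=\prod_{\tau\in G}\tau(1/Q(x))$. For $1\le i\le r$ let $\lambda_{i,1},\dots,\lambda_{i,p_i-1}\in\mathbb F_q$ be the values of $x_{i-1}$, in any fixed order, at the places of $F_{i-1}$, other than the pole of $x_{i-1}$, that lie over the pole of $x_i$. For $0\le i<r$ and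 $0\le e<p_{i+1}$ put $z_i^{(e)}=\prod_{k=1}^{e}(x_i-\lambda_{i+1,k})^{-1}$. Write $x_r=u_{r,0}(x)/\prod_\alpha(x-\alpha)$, the product being over all $\alpha\in\mathbb F_q$ such that the zero of $x-\alpha$ is a pole of $x_r$, and let $$\tilde{\mathcal B}=\{z_0^{(e_0)}z_1^{(e_1)}\cdots z_{r-1}^{(e_{r-1})}x_ry_r:\ 0\le e_i<p_{i+1}\}.$$ Let $\mathfrak P$ be a rational place of $F^G$ that splits completely in $F/F^G$ and that is the pole of $x_r$ if $n=q+1$, and not the pole of $x_r$ if $n<q+1$. Let $\mathcal P$ be the set of rational places of $F$ lying over $\mathfrak P$. Then $|\mathcal P|=n$, the family $\frac{Q^n}{u_{r,0}}\tilde{\mathcal B}$ is a basis of the space $\mathbb F_q[x]_{<n}$ of polynomials of degree less than $n$, and there is a straight-line program over $\mathbb F_q$ which, given the coefficients in this basis of an arbitrary $f\in\mathbb F_q[x]_{<n}$, computes the DFT of $f$ at $\mathcal P$, that is, the values $f(P)$ for all $P\in\mathcal P$ other than the pole $P_\infty$ of $x$ (if $n=q+1$, then $P_\infty\in\mathcal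 P$ and one sets $f(P_\infty):=\infty$ by convention), with $O(Bn\log n)$ operations in $\mathbb F_q$ and $O(n)$ precomputed constants of $\mathbb F_q$. The implied constants are absolute, and the program depends on all the data above but not on $f$. -/

import Mathlib

open Polynomial

namespace GFFT

universe u v w

/-! ### Straight-line programs over a field, with their cost -/

/-- The arithmetic operations that are counted. Division is not even needed, so it is not
offered: a program in this model is in particular a program with the four field operations. -/
inductive ArithOp
  | add
  | sub
  | mul

/-- The result of one operation. -/
def ArithOp.apply {K : Type u} [Field K] : ArithOp → K → K → K
  | .add, x, y => x + y
  | .sub, x, y => x - y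
  | .mul, x, y => x * y

/-- Straight-line code. `V` is the type of the memory cells that are already filled and `O` the
type of output positions. An instruction `step op l r rest` applies `op` to the contents of two
filled cells, writes the result to one new cell (the new cell is `none : Option V`, the old ones
are `some v`), and goes on with `rest`; `output out` stops and outputs the cell `out o` at the
position `o`. -/
inductive Code (O : Type v) : Type w → Type (max v (w + 1))
  | output {V : Type w} (out : O → V) : Code O V
  | step {V : Type w} (op : ArithOp) (l r : V) (rest : Code O (Option V)) : Code O V

/-- The number of arithmetic operations in the code. -/
def Code.numOps {O : Type v} : {V : Type w} → Code O V → ℕ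
  | _, .output _ => 0
  | _, .step _ _ _ rest => rest.numOps + 1

/-- Execution of the code on the memory contents `mem`. -/
def Code.eval {K : Type u} [Field K] {O : Type v} :
    {V : Type w} → Code O V → (V → K) → O → K
  | _, .output out, mem => fun o => mem (out o)
  | _, .step op l r rest, mem =>
      rest.eval (fun c => c.elim (op.apply (mem l) (mem r)) mem)

/-- A straight-line program with inputs indexed by `I` and outputs indexed by `O`: a table of
precomputed constants of the field (this is the precomputed storage), and code whose memory holds
at the start the inputs and the precomputed constants. -/
structure Program (K : Type u) (I : Type w) (O : Type v) where
  /-- the number of precomputed constants -/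
  storage : ℕ
  /-- the precomputed constants -/
  table : Fin storage → K
  /-- the code -/
  code : Code O (I ⊕ Fin storage)

/-- The number of operations of a program. -/
def Program.numOps {K : Type u} {I : Type w} {O : Type v} (P : Program K I O) : ℕ :=
  P.code.numOps

/-- The outputs of a program on the input `a`. -/
def Program.eval {K : Type u} [Field K] {I : Type w} {O : Type v} (P : Program K I O)
    (a : I → K) : O → K :=
  P.code.eval (Sum.elim a P.table)

/-! ### Places of function fields

A place is given by its valuation ring `O`; the elements of `O.nonunits` form its maximal ideal. -/

/-- `O` is the valuation ring of a place of the function field `E` over the constant field `K`. -/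
def IsPlace (K : Type u) {E : Type v} [Field K] [Field E] [Algebra K E]
    (O : ValuationSubring E) : Prop :=
  (∀ c : K, algebraMap K E c ∈ O) ∧ O ≠ ⊤

/-- `y` is regular at the place `O` and has residue class `c` in the constant field there. -/
def HasValue {K : Type u} {E : Type v} [Field K] [Field E] [Algebra K E]
    (O : ValuationSubring E) (y : E) (c : K) : Prop :=
  y - algebraMap K E c ∈ O.nonunits

/-- The place `O` is rational (of degree one): its residue field is `K`. -/
def IsRational (K : Type u) {E : Type v} [Field K] [Field E] [Algebra K E]
    (O : ValuationSubring E) : Prop :=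
  ∀ y ∈ O, ∃ c : K, HasValue O y c

section RationalFunctionField

variable {K : Type u} [Field K]

/-- The place `P` of `K(x)` lies over the place `Q` of the subfield `E`. -/
def LiesOver {E : IntermediateField K (RatFunc K)} (P : ValuationSubring (RatFunc K))
    (Q : ValuationSubring E) : Prop :=
  P.comap (algebraMap E (RatFunc K)) = Q

/-- The place `Q` of the subfield `E` splits completely in `K(x)`: there are `[K(x) : E]`
distinct places of `K(x)` over it. -/
def SplitsCompletely {E : IntermediateField K (RatFunc K)} (Q : ValuationSubring E) : Prop :=
  {P : ValuationSubring (RatFunc K) | IsPlace K P ∧ LiesOver P Q}.ncard =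
    Module.finrank E (RatFunc K)

/-- The set of rational places of `K(x)` lying over `Q`. -/
def rationalPlacesOver {E : IntermediateField K (RatFunc K)} (Q : ValuationSubring E) :
    Set (ValuationSubring (RatFunc K)) :=
  {P | IsPlace K P ∧ IsRational K P ∧ LiesOver P Q}

/-- The function `y`, an element of the subfield `E`, has a pole at the place `Q` of `E`. -/
def HasPole {E : IntermediateField K (RatFunc K)} (Q : ValuationSubring E) (y : RatFunc K) :
    Prop :=
  ∃ t : E, (t : RatFunc K) = y ∧ t ∉ Q

/-- For elements `y`, `z` of the subfield `E`: the (finite) values in `K` that `y` takes at those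
places of `E` at which `z` has a pole. -/
def valuesAtPoles (E : IntermediateField K (RatFunc K)) (y z : RatFunc K) : Set K :=
  {c | ∃ Q : ValuationSubring E, IsPlace K Q ∧ HasPole Q z ∧
    ∃ t : E, (t : RatFunc K) = y ∧ HasValue Q t c}

/-! ### The cyclic group and the functions built from it -/

/-- A primitive polynomial over a finite field: monic, irreducible, and with a root that
generates the multiplicative group of the extension field. -/
def IsPrimitiveOverFinite [Fintype K] (m : K[X]) : Prop :=
  m.Monic ∧ Irreducible m ∧ orderOf (AdjoinRoot.root m) = Fintype.card K ^ m.natDegree - 1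

/-- The subgroup of order `N` of `⟨σ⟩`, where `σ` has order `q + 1` and `N ∣ q + 1`. -/
noncomputable def subgroupOfOrder [Fintype K] (σ : RatFunc K ≃ₐ[K] RatFunc K) (N : ℕ) :
    Subgroup (RatFunc K ≃ₐ[K] RatFunc K) :=
  Subgroup.zpowers (σ ^ ((Fintype.card K + 1) / N))

/-- The sum of the conjugates of `x` under the (finite) group `H`. -/
noncomputable def traceX (H : Subgroup (RatFunc K ≃ₐ[K] RatFunc K)) : RatFunc K :=
  ∑ᶠ τ ∈ H, τ RatFunc.X

/-- The quadratic `Q(x) = x² + (a/b) x + 1/b`. -/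
noncomputable def quadQ (a b : K) : RatFunc K :=
  RatFunc.X ^ 2 + RatFunc.C (a / b) * RatFunc.X + RatFunc.C (1 / b)

/-- The product of the conjugates of `1 / Q(x)` under the (finite) group `H`. -/
noncomputable def normInvQ (a b : K) (H : Subgroup (RatFunc K ≃ₐ[K] RatFunc K)) : RatFunc K :=
  ∏ᶠ τ ∈ H, τ (1 / quadQ a b)

/-- The elements `α` of `K` such that the zero of `x - α` is a pole of `traceX G`. -/
def finitePoles (G : Subgroup (RatFunc K ≃ₐ[K] RatFunc K)) : Set K :=
  {α | ∃ P : ValuationSubring (RatFunc K), IsPlace K P ∧ HasValue P RatFunc.X α ∧ traceX G ∉ P}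

/-- The numerator `u` of `traceX G = u(x) / ∏ (x - α)`, the product being over the finite
poles `α`. -/
noncomputable def numeratorU (G : Subgroup (RatFunc K ≃ₐ[K] RatFunc K)) : RatFunc K :=
  traceX G * ∏ᶠ α ∈ finitePoles G, (RatFunc.X - RatFunc.C α)

/-- The order `p₁ ⋯ pᵢ` of the `i`-th group in the chain (`p₁, …, pᵣ` are indexed from `0`). -/
def chainOrder {r : ℕ} (p : Fin r → ℕ) (i : ℕ) : ℕ :=
  ∏ j : Fin r, if (j : ℕ) < i then p j else 1

/-- The `i`-th group `Gᵢ` in the chain, of order `p₁ ⋯ pᵢ`. -/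
noncomputable def chainGroup [Fintype K] (σ : RatFunc K ≃ₐ[K] RatFunc K) {r : ℕ} (p : Fin r → ℕ) (i : ℕ) :
    Subgroup (RatFunc K ≃ₐ[K] RatFunc K) :=
  subgroupOfOrder σ (chainOrder p i)

/-- `xᵢ`, the sum of the conjugates of `x` under `Gᵢ`. -/
noncomputable def chainX [Fintype K] (σ : RatFunc K ≃ₐ[K] RatFunc K) {r : ℕ} (p : Fin r → ℕ)
    (i : ℕ) : RatFunc K :=
  traceX (chainGroup σ p i)

/-- For each `i < r`, the list `l i` enumerates without repetition the values `λ` of `xᵢ` at the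
places of the fixed field of `Gᵢ`, other than the pole of `xᵢ`, that lie over the pole
of `xᵢ₊₁`. -/
def IsPoleEnumeration [Fintype K] (σ : RatFunc K ≃ₐ[K] RatFunc K) {r : ℕ} (p : Fin r → ℕ)
    (l : Fin r → List K) : Prop :=
  ∀ i : Fin r, (l i).Nodup ∧ ∀ c : K, c ∈ l i ↔
    c ∈ valuesAtPoles (IntermediateField.fixedField (chainGroup σ p i))
      (chainX σ p i) (chainX σ p (i + 1))

/-- `zᵢ⁽ᵉ⁾ = 1 / ((xᵢ - λ₁) ⋯ (xᵢ - λₑ))`, with the first `e` values of the list `l i`. -/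
noncomputable def zElt [Fintype K] (σ : RatFunc K ≃ₐ[K] RatFunc K) {r : ℕ} (p : Fin r → ℕ)
    (l : Fin r → List K) (i : Fin r) (e : ℕ) : RatFunc K :=
  1 / (((l i).take e).map fun c => chainX σ p i - RatFunc.C c).prod

/-- The element `z₀⁽ᵉ⁰⁾ z₁⁽ᵉ¹⁾ ⋯ xᵣ yᵣ` with index `e`, where `xᵣ`, `yᵣ` belong to the
group `G`. -/
noncomputable def tildeB [Fintype K] (a b : K) (σ : RatFunc K ≃ₐ[K] RatFunc K)
    (G : Subgroup (RatFunc K ≃ₐ[K] RatFunc K)) {r : ℕ} (p : Fin r → ℕ) (l : Fin r → List K)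
    (e : ∀ i : Fin r, Fin (p i)) : RatFunc K :=
  (∏ i : Fin r, zElt σ p l i (e i)) * traceX G * normInvQ a b G

end RationalFunctionField

end GFFT

/-!
The group `⟨σ⟩` acts on the projective line over `K` like multiplication by the primitive element
`θ` on the lines through the origin of `K[θ]`: with `θ ^ k = s + t θ` and the linear polynomial
`Lₖ = s x + t` one has `σ ^ k (x) = Lₖ / Lₖ₊₁`. Since `θ ^ k` is a scalar only for `q + 1 ∣ k`, the
action on the rational places is free (`eq_one_of_pullback_eq`) and `σ` has order `q + 1`. Hence, for
a subgroup `H`, the partial fractions of the `τ x`, `τ ∈ H`, have distinct poles, and the trace of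
`x` is `U / D` with `D = ∏ (x - α)` over the conjugates `α ≠ ∞` of `∞`, with `U` monic of degree
`|H|` and prime to `D`; the norm of `1 / Q` is a constant times `D² / Q ^ |H|`
(`exists_isTraceData`).

For consecutive groups of the chain, a count of degrees against the size of the `H`-orbits gives
`Dᵢ₊₁ = Dᵢ ∏ₖ (Uᵢ - λₖ Dᵢ)`, the product being over exactly `pᵢ₊₁ - 1` values `λₖ`
(`length_and_rootPoly_eq`). All denominators therefore cancel, and an element of the family
`Q ^ n / u · tildeB` is, up to one constant, the polynomial
`∏ᵢ Dᵢ ^ eᵢ ∏_{k > eᵢ} (Uᵢ - λₖ Dᵢ)` (`quadQ_pow_div_mul_tildeB`). Linear independence follows from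
the top level down: modulo `U - λ D` with the last `λ`, only one power of `D` is left
(`levelPoly_independent`).

Each factor is a form of degree `pᵢ₊₁ - 1` in `(Uᵢ : Dᵢ)`, that is, in the value of `xᵢ` on the
projective line, and this value depends only on the `Gᵢ`-orbit of the point. So at a point the basis
polynomials are products of level forms in orbit-invariant arguments, multiplied by a scalar that
does not depend on the basis element; poles of `xᵢ` need no separate treatment. The places over `𝔓`
are one free orbit (`ncard_rationalPlacesOver`), numbered by the powers of a generator, and the
values of `xᵢ` are periodic of period `n / |Gᵢ|` in this numbering. Summing over one index at a time
and evaluating the level forms by Horner's scheme costs `3 n pᵢ₊₁` operations per level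
(`reach_fft`), with the values of the `xᵢ` on the orbits, the `λ` and the final scalars as
precomputed constants.
-/

namespace GFFT

universe u v w

/-! ### Straight-line computation without memory cells -/

/-- `Reach S t T`: starting with the functions in `S` (functions of the input `x : X`), at most
`t` arithmetic operations suffice to have every function in `T` available. This describes
straight-line code up to the naming of its memory cells. -/
inductive Reach {X : Type v} {K : Type u} [Field K] :
    Set (X → K) → ℕ → Set (X → K) → Prop
  | done {S T : Set (X → K)} (t : ℕ) (h : T ⊆ S) : Reach S t T
  | step {S T : Set (X → K)} {t : ℕ} (op : ArithOp) {f g : X → K} (hf : f ∈ S) (hg : g ∈ S)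
      (h : Reach (insert (fun x => op.apply (f x) (g x)) S) t T) : Reach S (t + 1) T

section Reach

variable {X : Type v} {K : Type u} [Field K]

theorem Reach.mono {S S' T : Set (X → K)} {t t' : ℕ} (h : Reach S t T) (hS : S ⊆ S')
    (ht : t ≤ t') : Reach S' t' T := by
  induction h generalizing S' t' with
  | done t h => exact .done _ (h.trans hS)
  | step op hf hg h ih =>
    obtain ⟨t', rfl⟩ : ∃ s, t' = s + 1 := ⟨t' - 1, by omega⟩
    exact .step op (hS hf) (hS hg) (ih (Set.insert_subset_insert hS) (by omega))

theorem Reach.anti {S T T' : Set (X → K)} {t : ℕ} (h : Reach S t T) (hT : T' ⊆ T) :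
    Reach S t T' := by
  induction h with
  | done t h => exact .done _ (hT.trans h)
  | step op hf hg h ih => exact .step op hf hg (ih hT)

theorem Reach.trans {S T U : Set (X → K)} {t t' : ℕ} (h : Reach S t T)
    (h' : Reach (S ∪ T) t' U) : Reach S (t + t') U := by
  induction h with
  | done t h => exact h'.mono (by simp [h]) (by omega)
  | @step S T t op f g hf hg h ih =>
    rw [add_right_comm]
    exact .step op hf hg (ih (h'.mono (Set.union_subset_union_left _ (Set.subset_insert _ _)) le_rfl))

theorem Reach.union {S T T' : Set (X → K)} {t t' : ℕ} (h : Reach S t T) (h' : Reach S t' T') :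
    Reach S (t + t') (T ∪ T') := by
  have h2 : Reach S t (S ∪ T) := by
    clear h'
    induction h with
    | done t h => exact .done _ (by simp [h])
    | step op hf hg h ih =>
      exact .step op hf hg (ih.anti (Set.union_subset_union_left _ (Set.subset_insert _ _)))
  have h3 : Reach (S ∪ T) t' (T ∪ T') := by
    clear h h2
    induction h' with
    | done t h => exact .done _ (by
        rw [Set.union_subset_iff]
        exact ⟨Set.subset_union_right, h.trans Set.subset_union_left⟩)
    | step op hf hg h ih =>
      refine .step op (Or.inl hf) (Or.inl hg) ?_
      rw [← Set.insert_union]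
      exact ih
  exact h2.trans (h3.mono (by simp) le_rfl)

theorem Reach.iUnion {ι : Type*} {S : Set (X → K)} {T : ι → Set (X → K)} {t : ℕ}
    (s : Finset ι) (h : ∀ i ∈ s, Reach S t (T i)) : Reach S (s.card * t) (⋃ i ∈ s, T i) := by
  classical
  induction s using Finset.induction_on with
  | empty => exact .done _ (by simp)
  | insert a s ha ih =>
    rw [Finset.card_insert_of_notMem ha, Finset.set_biUnion_insert, add_mul, one_mul, add_comm]
    exact (h a (Finset.mem_insert_self _ _)).union
      (ih fun i hi => h i (Finset.mem_insert_of_mem hi))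

/-- Realization of an abstract computation by code: name the memory cells by `m`. -/
theorem Reach.exists_code {S T : Set (X → K)} {t : ℕ} (h : Reach S t T) :
    ∀ {V : Type w} (m : V → X → K) (_ : S ⊆ Set.range m) {O : Type*} (g : O → X → K)
      (_ : ∀ o, g o ∈ T), ∃ code : Code O V, code.numOps ≤ t ∧
        ∀ x o, code.eval (fun v => m v x) o = g o x := by
  induction h with
  | done t h =>
    intro V m hm O g hg
    choose out hout using fun o => hm (h (hg o))
    refine ⟨.output out, by simp [Code.numOps], fun x o => ?_⟩
    simp [Code.eval, hout]
  | @step S T t op f g hf hg h ih =>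
    intro V m hm O out hout
    obtain ⟨l, rfl⟩ := hm hf
    obtain ⟨r, rfl⟩ := hm hg
    obtain ⟨code, hcode, heval⟩ := ih
      (fun c : Option V => c.elim (fun x => op.apply (m l x) (m r x)) m)
      (by
        rintro _ (rfl | h)
        · exact ⟨none, rfl⟩
        · obtain ⟨v, rfl⟩ := hm h
          exact ⟨some v, rfl⟩) out hout
    refine ⟨.step op l r code, by simpa [Code.numOps] using hcode, fun x o => ?_⟩
    rw [Code.eval, ← heval x o]
    congr 1
    funext c
    cases c <;> rfl

/-- A computation from the input coordinates and finitely many constants is a program. -/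
theorem Reach.exists_program {I : Type w} {O : Type*}
    {S T : Set ((I → K) → K)} {t : ℕ}
    (h : Reach S t T) (c : Finset K)
    (hS : ∀ f ∈ S, (∃ i, f = fun a => a i) ∨ ∃ k ∈ c, f = fun _ => k)
    (g : O → (I → K) → K) (hg : ∀ o, g o ∈ T) :
    ∃ A : Program K I O, A.numOps ≤ t ∧ A.storage = c.card ∧ ∀ a o, A.eval a o = g o a := by
  obtain ⟨code, h1, h2⟩ := h.exists_code
    (Sum.elim (fun i a => a i) (fun j _ => (c.equivFin.symm j : K)) :
      I ⊕ Fin c.card → (I → K) → K)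
    (by
      intro f hf
      obtain ⟨i, rfl⟩ | ⟨k, hk, rfl⟩ := hS f hf
      · exact ⟨.inl i, rfl⟩
      · exact ⟨.inr (c.equivFin ⟨k, hk⟩), by simp⟩) g hg
  refine ⟨⟨c.card, fun j => c.equivFin.symm j, code⟩, h1, rfl, fun a o => ?_⟩
  rw [Program.eval, ← h2 a o]
  congr 1
  funext v
  cases v <;> rfl

/-! ### The butterfly recursion -/

/-- The value at `ξ ∈ K ∪ {∞}` of the form `∏_{k > e} (ξ - λₖ)`, homogeneous of degree the length
of `lam`, in the affine coordinate if `ξ` is finite and in the coordinate `1 / ξ` if `ξ = ∞`, which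
is encoded as `none`. -/
def levelForm (ξ : Option K) (lam : List K) (e : ℕ) : K :=
  ξ.elim (0 ^ e) fun x => ((lam.drop e).map fun c => x - c).prod

/-- Horner's scheme, from the last factor of `∏_{k > e} (x - λₖ)` inwards, so that no inverse of
`x - λₖ` is needed. -/
theorem reach_horner (x : K) (lam : List K) (g : ℕ → X → K) (S : Set (X → K))
    (hx : (fun _ => x) ∈ S) (hl : ∀ c ∈ lam, (fun _ => c) ∈ S)
    (hg : ∀ e ≤ lam.length, g e ∈ S) :
    Reach S (3 * lam.length)
      {fun a => ∑ e ∈ Finset.range (lam.length + 1), g e a * levelForm (some x) lam e} := by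
  induction lam using List.reverseRecOn with
  | nil => exact .done _ (by simpa [levelForm] using hg 0)
  | append_singleton lam c ih =>
    have h1 := ih (fun d hd => hl d (by simp [hd])) (fun e he => hg e (by simp; omega))
    rw [List.length_append, List.length_singleton, mul_add]
    refine h1.trans ?_
    have hc := hl c (by simp)
    have hl' := hg (lam.length + 1) (by simp)
    refine .step .sub (Or.inl hx) (Or.inl hc) (.step .mul (Or.inr (Or.inr rfl)) (Or.inl rfl)
      (.step .add (Or.inl rfl) (Or.inr (Or.inr (Or.inl hl'))) (.done _ ?_)))
    rintro _ rfl
    left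
    funext a
    have : ∀ e ∈ Finset.range (lam.length + 1), g e a * levelForm (some x) (lam ++ [c]) e
        = (g e a * levelForm (some x) lam e) * (x - c) := by
      intro e he
      have : e ≤ lam.length := by simpa [Nat.lt_succ_iff] using he
      simp [levelForm, List.drop_append_of_le_length this, mul_assoc]
    rw [Finset.sum_range_succ, Finset.sum_congr rfl this, ← Finset.sum_mul]
    simp [ArithOp.apply, levelForm]

theorem reach_level (ξ : Option K) (lam : List K) (g : ℕ → X → K) (S : Set (X → K))
    (hx : ∀ x, ξ = some x → (fun _ => x) ∈ S) (hl : ∀ c ∈ lam, (fun _ => c) ∈ S)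
    (hg : ∀ e ≤ lam.length, g e ∈ S) :
    Reach S (3 * lam.length)
      {fun a => ∑ e ∈ Finset.range (lam.length + 1), g e a * levelForm ξ lam e} := by
  cases ξ with
  | some x => exact reach_horner x lam g S (hx x rfl) hl hg
  | none =>
    refine .done _ ?_
    rintro _ rfl
    convert hg 0 (by simp) using 1
    funext a
    simp [Finset.sum_range_succ', levelForm]

/-- The sums `∑ₑ Aₑ ∏ᵢ hᵢ(ξᵢ(j))` for all `j`, where `hᵢ` is the level form with index `eᵢ`. As
`ξᵢ` has period `Mᵢ`, for each first index `e₀` the inner sum over the remaining indices is needed at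
only `M₁ = M₀ / p₀` points, so that each level costs at most `3 M₀ pᵢ` operations. -/
theorem reach_fft {r : ℕ} : ∀ (p : Fin r → ℕ) (M : ℕ → ℕ) (ξ : Fin r → ℕ → Option K)
    (lam : Fin r → List K) (_ : ∀ i, (lam i).length + 1 = p i)
    (_ : ∀ i : Fin r, M i = p i * M (i + 1)) (_ : M r = 1)
    (_ : ∀ i j, ξ i (j % M i) = ξ i j) (S : Set (X → K)) (A : (∀ i, Fin (p i)) → X → K)
    (_ : ∀ e, A e ∈ S) (_ : ∀ i j x, ξ i j = some x → (fun _ => x) ∈ S)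
    (_ : ∀ i, ∀ c ∈ lam i, (fun _ => c) ∈ S),
    Reach S (3 * M 0 * ∑ i, p i)
      {F | ∃ j : ℕ, F = fun x => ∑ e, A e x * ∏ i, levelForm (ξ i j) (lam i) (e i)} := by
  induction r with
  | zero =>
    intro p M ξ lam hlam hM hMr hξ S A hA hx hl
    refine .done _ ?_
    rintro _ ⟨j, rfl⟩
    simpa using hA _
  | succ r ih =>
    intro p M ξ lam hlam hM hMr hξ S A hA hx hl
    have hM0 : M 0 = p 0 * M 1 := by simpa using hM 0
    -- the sums over the tail of the index, for a fixed first entry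
    let F (e₀ : Fin (p 0)) (j : ℕ) (x : X) : K := ∑ e : ∀ i : Fin r, Fin (p i.succ),
      A (Fin.cons e₀ e) x * ∏ i : Fin r, levelForm (ξ i.succ j) (lam i.succ) (e i)
    have h1 : ∀ e₀ : Fin (p 0), Reach S (3 * M 1 * ∑ i : Fin r, p i.succ)
        {G | ∃ j : ℕ, G = F e₀ j} := fun e₀ =>
      ih (fun i => p i.succ) (fun k => M (k + 1)) (fun i => ξ i.succ) (fun i => lam i.succ)
        (fun i => hlam _) (fun i => by simpa using hM i.succ) hMr
        (fun i j => by simpa using hξ i.succ j) S (fun e => A (Fin.cons e₀ e))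
        (fun e => hA _) (fun i j x h => hx _ _ x h) (fun i c hc => hl _ c hc)
    have h2 := Reach.iUnion Finset.univ fun e₀ _ => h1 e₀
    -- the full sum is one application of the level form of the first level
    have key : ∀ j : ℕ, (fun x => ∑ e, A e x * ∏ i, levelForm (ξ i j) (lam i) (e i)) =
        fun x => ∑ e ∈ Finset.range ((lam 0).length + 1),
          (if h : e < p 0 then F ⟨e, h⟩ j x else 0) * levelForm (ξ 0 j) (lam 0) e := by
      intro j
      funext x
      rw [← Equiv.sum_comp (Fin.consEquiv fun i => Fin (p i)), Fintype.sum_prod_type, hlam 0,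
        Finset.sum_range]
      refine Finset.sum_congr rfl fun e₀ _ => ?_
      simp only [F, Fin.consEquiv_apply, Fin.prod_univ_succ, Fin.cons_zero, Fin.cons_succ,
        e₀.2, dite_true, Fin.eta]
      rw [Finset.sum_mul]
      refine Finset.sum_congr rfl fun e _ => ?_
      change A (Fin.cons e₀ e) x * (_ * _) = _
      ring
    have h3 : ∀ j ∈ Finset.range (M 0),
        Reach (S ∪ ⋃ e₀ ∈ (Finset.univ : Finset (Fin (p 0))), {G | ∃ j : ℕ, G = F e₀ j}) (3 * p 0)
          {fun x => ∑ e, A e x * ∏ i, levelForm (ξ i j) (lam i) (e i)} := by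
      intro j _
      rw [key j]
      refine (reach_level (ξ 0 j) (lam 0)
        (fun e x => if h : e < p 0 then F ⟨e, h⟩ j x else 0) _
        (fun x h => Or.inl (hx 0 j x h)) (fun c hc => Or.inl (hl 0 c hc)) ?_).mono subset_rfl
        (by have := hlam 0; omega)
      intro e he
      have he' : e < p 0 := by have := hlam 0; omega
      simp only [he', dite_true]
      exact Or.inr (Set.mem_iUnion₂.2 ⟨⟨e, he'⟩, Finset.mem_univ _, j, rfl⟩)
    have h4 := h2.trans (Reach.iUnion _ h3)
    refine (h4.mono subset_rfl ?_).anti ?_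
    · rw [Finset.card_univ, Fintype.card_fin, Finset.card_range, Fin.sum_univ_succ, hM0]
      apply le_of_eq
      ring
    · rintro _ ⟨j, rfl⟩
      have hM0' : 0 < M 0 := by
        have : ∀ k ≤ r + 1, 0 < M (r + 1 - k) := by
          intro k
          induction k with
          | zero => intro _; simp [hMr]
          | succ k ihk =>
            intro hk
            have h5 := hM ⟨r + 1 - (k + 1), by omega⟩
            have h6 := hlam ⟨r + 1 - (k + 1), by omega⟩
            simp only [show r + 1 - (k + 1) + 1 = r + 1 - k by omega] at h5
            rw [h5]
            exact Nat.mul_pos (by omega) (ihk (by omega))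
        simpa using this (r + 1) le_rfl
      refine Set.mem_iUnion₂.2 ⟨j % M 0, Finset.mem_range.2 (Nat.mod_lt _ hM0'), ?_⟩
      have hdvd : ∀ k, ∀ hk : k < r + 1, M k ∣ M 0 := by
        intro k
        induction k with
        | zero => simp
        | succ k ihk =>
          intro hk
          refine Dvd.dvd.trans ?_ (ihk (by omega))
          exact ⟨p ⟨k, by omega⟩, by rw [mul_comm]; exact hM ⟨k, by omega⟩⟩
      have : ∀ i : Fin (r + 1), ξ i (j % M 0) = ξ i j := by
        intro i
        rw [← hξ i (j % M 0), Nat.mod_mod_of_dvd _ (hdvd i i.2), hξ]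
      simp [this]

end Reach

/-- The butterfly recursion as a program, with a scalar `sc j` multiplied onto the `j`-th value at
the end. -/
theorem exists_fft_program {K : Type u} [Field K] {r : ℕ} (p : Fin r → ℕ) (M : ℕ → ℕ)
    (ξ : Fin r → ℕ → Option K)
    (lam : Fin r → List K) (hlam : ∀ i, (lam i).length + 1 = p i)
    (hM : ∀ i : Fin r, M i = p i * M (i + 1)) (hMr : M r = 1)
    (hξ : ∀ i j, ξ i (j % M i) = ξ i j) (sc : ℕ → K) {O : Type*} (idx : O → ℕ)
    (hidx : ∀ o, idx o < M 0) :
    ∃ A : Program K (∀ i, Fin (p i)) O, A.numOps ≤ 3 * M 0 * ∑ i, p i + M 0 ∧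
      A.storage ≤ ∑ i : Fin r, M i + ∑ i, p i + M 0 ∧
      ∀ a o, A.eval a o =
        (∑ e, a e * ∏ i, levelForm (ξ i (idx o)) (lam i) (e i)) * sc (idx o) := by
  classical
  have hMpos : ∀ i : Fin r, 0 < M i := by
    have : ∀ k ≤ r, 0 < M (r - k) := by
      intro k
      induction k with
      | zero => intro _; simp [hMr]
      | succ k ihk =>
        intro hk
        have h5 := hM ⟨r - (k + 1), by omega⟩
        have h6 := hlam ⟨r - (k + 1), by omega⟩
        simp only [show r - (k + 1) + 1 = r - k by omega] at h5
        rw [h5]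
        exact Nat.mul_pos (by omega) (ihk (by omega))
    intro i
    have := this (r - i) (by omega)
    rwa [Nat.sub_sub_self i.2.le] at this
  -- the precomputed constants
  let cξ : Finset K := Finset.univ.biUnion fun i : Fin r =>
    (Finset.range (M i)).image fun j => (ξ i j).getD 0
  let cl : Finset K := Finset.univ.biUnion fun i : Fin r => (lam i).toFinset
  let cs : Finset K := (Finset.range (M 0)).image sc
  let c : Finset K := cξ ∪ cl ∪ cs
  have hcard : c.card ≤ ∑ i : Fin r, M i + ∑ i, p i + M 0 := by
    refine (Finset.card_union_le _ _).trans (add_le_add ((Finset.card_union_le _ _).trans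
      (add_le_add ?_ ?_)) ?_)
    · refine Finset.card_biUnion_le.trans (Finset.sum_le_sum fun i _ => ?_)
      exact Finset.card_image_le.trans (by simp)
    · refine Finset.card_biUnion_le.trans (Finset.sum_le_sum fun i _ => ?_)
      exact (List.toFinset_card_le _).trans (by have := hlam i; omega)
    · exact Finset.card_image_le.trans (by simp)
  let S : Set (((∀ i, Fin (p i)) → K) → K) :=
    {f | (∃ i, f = fun a => a i) ∨ ∃ k ∈ c, f = fun _ => k}
  have h1 := reach_fft p M ξ lam hlam hM hMr hξ S (fun e a => a e) (fun e => Or.inl ⟨e, rfl⟩)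
    (fun i j x h => Or.inr ⟨x, by
      refine Finset.mem_union_left _ (Finset.mem_union_left _ (Finset.mem_biUnion.2
        ⟨i, Finset.mem_univ _, Finset.mem_image.2 ⟨j % M i,
          Finset.mem_range.2 (Nat.mod_lt _ (hMpos i)), ?_⟩⟩))
      rw [hξ, h]; rfl, rfl⟩)
    (fun i d hd => Or.inr ⟨d, Finset.mem_union_left _ (Finset.mem_union_right _
      (Finset.mem_biUnion.2 ⟨i, Finset.mem_univ _, List.mem_toFinset.2 hd⟩)), rfl⟩)
  let F (j : ℕ) (a : (∀ i, Fin (p i)) → K) : K :=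
    ∑ e, a e * ∏ i, levelForm (ξ i j) (lam i) (e i)
  have h2 := h1.trans (Reach.iUnion (Finset.range (M 0)) (t := 1)
    (T := fun j => {fun a => F j a * sc j}) fun j hj =>
      .step .mul (f := F j) (g := fun _ => sc j) (Or.inr ⟨j, rfl⟩)
        (Or.inl (Or.inr ⟨sc j, Finset.mem_union_right _ (Finset.mem_image_of_mem _ hj), rfl⟩))
        (.done 0 (by rintro _ rfl; left; rfl)))
  obtain ⟨A, hA, hs, he⟩ := h2.exists_program c (fun f hf => hf)
    (fun (o : O) a => F (idx o) a * sc (idx o))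
    (fun o => Set.mem_iUnion₂.2 ⟨idx o, Finset.mem_range.2 (hidx o), rfl⟩)
  exact ⟨A, by simpa using hA, hs ▸ hcard, he⟩

/-! ### Values at places -/

section Places

variable {K : Type u} {E : Type v} [Field K] [Field E] [Algebra K E] {O : ValuationSubring E}

theorem mem_nonunits_of_notMem {E : Type v} [Field E] {O : ValuationSubring E} {y : E}
    (h : y ∉ O) : y⁻¹ ∈ O.nonunits :=
  O.inv_mem_nonunits_iff.2 (Or.inr h)

theorem notMem_of_mem_nonunits {E : Type v} [Field E] {O : ValuationSubring E} {y : E}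
    (h : y ∈ O.nonunits) (h0 : y ≠ 0) : y⁻¹ ∉ O :=
  (O.mem_nonunits_iff_or.1 h).resolve_left h0

theorem mul_mem_nonunits {E : Type v} [Field E] {O : ValuationSubring E} {y z : E}
    (hy : y ∈ O) (hz : z ∈ O.nonunits) : y * z ∈ O.nonunits := by
  rw [ValuationSubring.mem_nonunits_iff] at hz ⊢
  rw [map_mul]
  exact (mul_le_of_le_one_left' ((O.valuation_le_one_iff _).2 hy)).trans_lt hz

theorem mem_of_mem_nonunits {E : Type v} [Field E] {O : ValuationSubring E} {y : E}
    (hz : y ∈ O.nonunits) : y ∈ O := O.nonunits_subset hz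

theorem IsPlace.algebraMap_notMem_nonunits (hO : IsPlace K O) {c : K} (hc : c ≠ 0) :
    algebraMap K E c ∉ O.nonunits := fun h =>
  notMem_of_mem_nonunits h (by simpa using hc) (by rw [← map_inv₀]; exact hO.1 _)

theorem HasValue.mem (hO : IsPlace K O) {y : E} {c : K} (h : HasValue O y c) : y ∈ O := by
  have := O.add_mem _ _ (mem_of_mem_nonunits h) (hO.1 c)
  simpa using this

theorem hasValue_algebraMap (c : K) : HasValue O (algebraMap K E c) c := by
  rw [HasValue, sub_self]
  exact O.nonunits.zero_mem

theorem HasValue.add {y z : E} {c d : K} (hy : HasValue O y c) (hz : HasValue O z d) :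
    HasValue O (y + z) (c + d) := by
  have := O.nonunits.add_mem hy hz
  rwa [HasValue, map_add, show y + z - (algebraMap K E c + algebraMap K E d) =
    (y - algebraMap K E c) + (z - algebraMap K E d) by ring]

theorem HasValue.mul (hO : IsPlace K O) {y z : E} {c d : K} (hy : HasValue O y c)
    (hz : HasValue O z d) : HasValue O (y * z) (c * d) := by
  have := O.nonunits.add_mem (mul_mem_nonunits (hy.mem hO) hz) (mul_mem_nonunits (hO.1 d) hy)
  rwa [HasValue, map_mul, show y * z - algebraMap K E c * algebraMap K E d =
    y * (z - algebraMap K E d) + algebraMap K E d * (y - algebraMap K E c) by ring]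

theorem HasValue.unique (hO : IsPlace K O) {y : E} {c d : K} (hc : HasValue O y c)
    (hd : HasValue O y d) : c = d := by
  by_contra hne
  refine hO.algebraMap_notMem_nonunits (sub_ne_zero.2 hne) ?_
  have := O.nonunits.sub_mem hd hc
  rwa [map_sub, show algebraMap K E c - algebraMap K E d =
    (y - algebraMap K E d) - (y - algebraMap K E c) by ring]

theorem hasValue_zero_iff {y : E} : HasValue O y (0 : K) ↔ y ∈ O.nonunits := by
  simp [HasValue]

theorem HasValue.ne_zero (hO : IsPlace K O) {y : E} {c : K} (h : HasValue O y c) (hc : c ≠ 0) :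
    y ≠ 0 := by
  rintro rfl
  exact hc (h.unique hO (by simpa using hasValue_algebraMap (O := O) (0 : K)))

theorem HasValue.inv (hO : IsPlace K O) {y : E} {c : K} (h : HasValue O y c) (hc : c ≠ 0) :
    HasValue O y⁻¹ c⁻¹ := by
  have hy := h.ne_zero hO hc
  have hmem : y⁻¹ ∈ O := by
    by_contra hn
    have := mem_nonunits_of_notMem hn
    rw [inv_inv] at this
    exact hc (h.unique hO (hasValue_zero_iff.2 this))
  have hc' : algebraMap K E c ≠ 0 := by simpa using hc
  have h1 := mul_mem_nonunits (O.mul_mem _ _ (O.neg_mem _ hmem) (hO.1 c⁻¹)) h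
  rw [HasValue]
  convert h1 using 1
  rw [map_inv₀]
  field_simp
  ring

theorem HasValue.div (hO : IsPlace K O) {y z : E} {c d : K} (hy : HasValue O y c)
    (hz : HasValue O z d) (hd : d ≠ 0) : HasValue O (y / z) (c / d) := by
  rw [div_eq_mul_inv, div_eq_mul_inv]
  exact hy.mul hO (hz.inv hO hd)

theorem HasValue.aeval (hO : IsPlace K O) {y : E} {c : K} (h : HasValue O y c) (f : K[X]) :
    HasValue O (Polynomial.aeval y f) (f.eval c) := by
  induction f using Polynomial.induction_on' with
  | add f g hf hg => simpa using hf.add hg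
  | monomial n d =>
    rw [aeval_monomial, eval_monomial]
    refine (hasValue_algebraMap d).mul hO ?_
    induction n with
    | zero => simpa using hasValue_algebraMap (O := O) (1 : K)
    | succ n ih => rw [pow_succ, pow_succ]; exact ih.mul hO h

theorem div_notMem (hO : IsPlace K O) {y z : E} {c : K} (hy : HasValue O y c) (hc : c ≠ 0)
    (hz : z ∈ O.nonunits) (hz0 : z ≠ 0) : y / z ∉ O := by
  intro h
  have h1 := mul_mem_nonunits h hz
  rw [div_mul_cancel₀ _ hz0] at h1
  exact hc (hy.unique hO (hasValue_zero_iff.2 h1))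

theorem add_mem_iff_right_of_mem {E : Type v} [Field E] {O : ValuationSubring E} {y z : E}
    (hy : y ∈ O) : y + z ∈ O ↔ z ∈ O :=
  ⟨fun h => by simpa using O.toSubring.sub_mem h hy, fun h => O.add_mem _ _ hy h⟩

/-! ### Pulling back places -/

section Comap

variable {E' : Type w} [Field E'] [Algebra K E'] (φ : E' →ₐ[K] E)

theorem mem_nonunits_comap {E : Type v} {E' : Type w} [Field E] [Field E'] (φ : E' →+* E)
    {O : ValuationSubring E} {y : E'} :
    y ∈ (O.comap φ).nonunits ↔ φ y ∈ O.nonunits := by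
  rw [ValuationSubring.mem_nonunits_iff_or, ValuationSubring.mem_nonunits_iff_or,
    ValuationSubring.mem_comap, map_inv₀, map_eq_zero]

theorem hasValue_comap {y : E'} {c : K} :
    HasValue (O.comap (φ : E' →+* E)) y c ↔ HasValue O (φ y) c := by
  rw [HasValue, HasValue, mem_nonunits_comap]
  simp

/-- Every valuation ring of a subfield is the trace of a valuation ring of the field. -/
theorem exists_comap_eq {E : Type v} {E' : Type w} [Field E] [Field E'] (φ : E' →+* E)
    (Q : ValuationSubring E') : ∃ P : ValuationSubring E, P.comap φ = Q := by
  obtain ⟨P, hle, hloc⟩ := (Q.toLocalSubring.map φ).exists_le_valuationSubring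
  have hQP : ∀ y ∈ Q, φ y ∈ P := fun y hy => hle ⟨y, hy, rfl⟩
  have hnon : ∀ y ∈ Q, φ y⁻¹ ∈ P → y⁻¹ ∈ Q := by
    intro y hy hinv
    by_cases h0 : y = 0
    · simp [h0]
    let a : (Q.toLocalSubring.map φ).toSubring := ⟨φ y, y, hy, rfl⟩
    have hu : IsUnit (Subring.inclusion hle a) := by
      refine IsUnit.of_mul_eq_one (⟨φ y⁻¹, hinv⟩ : P.toLocalSubring.toSubring) ?_
      refine Subtype.ext ?_
      change φ y * φ y⁻¹ = 1
      rw [← map_mul, mul_inv_cancel₀ h0, map_one]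
    obtain ⟨⟨_, z, hz, rfl⟩, hb⟩ := isUnit_iff_exists_inv.1 (hloc.map_nonunit a hu)
    have h1 : φ y * φ z = 1 := congrArg Subtype.val hb
    rw [← map_mul, ← map_one φ] at h1
    have h2 := φ.injective h1
    rwa [inv_eq_of_mul_eq_one_right h2]
  refine ⟨P, SetLike.ext fun y => ?_⟩
  rw [ValuationSubring.mem_comap]
  refine ⟨fun h => ?_, hQP y⟩
  rcases Q.mem_or_inv_mem y with h' | h'
  · exact h'
  · simpa using hnon y⁻¹ h' (by simpa using h)

end Comap

end Places

/-! ### Places of the rational function field -/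

section RatFunc

variable {K : Type u} [Field K]

theorem algebraMap_eq_aeval (f : K[X]) :
    algebraMap K[X] (RatFunc K) f = aeval RatFunc.X f := by
  conv_lhs => rw [← aeval_X_left_apply f]
  rw [← aeval_algebraMap_apply, RatFunc.algebraMap_X]

variable {P P' : ValuationSubring (RatFunc K)}

theorem algebraMap_mem (hP : IsPlace K P) (hX : RatFunc.X ∈ P) (f : K[X]) :
    algebraMap K[X] (RatFunc K) f ∈ P := by
  induction f using Polynomial.induction_on' with
  | add f g hf hg => rw [map_add]; exact P.add_mem _ _ hf hg
  | monomial n d =>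
    rw [← C_mul_X_pow_eq_monomial, map_mul, map_pow, RatFunc.algebraMap_X,
      RatFunc.algebraMap_C]
    refine P.mul_mem _ _ ?_ (pow_mem hX n)
    simpa [RatFunc.algebraMap_eq_C] using hP.1 d

theorem HasValue.polynomial (hP : IsPlace K P) {α : K} (h : HasValue P RatFunc.X α) (f : K[X]) :
    HasValue P (algebraMap K[X] (RatFunc K) f) (f.eval α) := by
  rw [algebraMap_eq_aeval]
  exact h.aeval hP f

/-- A place where `x` is regular is given by an irreducible polynomial `π`. -/
theorem mem_nonunits_iff_dvd (hP : IsPlace K P) (hX : RatFunc.X ∈ P) {π : K[X]}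
    (hπ : Irreducible π) (h : algebraMap K[X] (RatFunc K) π ∈ P.nonunits) (f : K[X]) :
    algebraMap K[X] (RatFunc K) f ∈ P.nonunits ↔ π ∣ f := by
  constructor
  · intro hf
    by_contra hnd
    obtain ⟨s, t, hst⟩ := (hπ.coprime_iff_not_dvd).2 hnd
    have h1 := P.nonunits.add_mem (mul_mem_nonunits (algebraMap_mem hP hX s) h)
      (mul_mem_nonunits (algebraMap_mem hP hX t) hf)
    rw [← map_mul, ← map_mul, ← map_add, hst, map_one] at h1
    exact hP.algebraMap_notMem_nonunits one_ne_zero (by simpa using h1)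
  · rintro ⟨g, rfl⟩
    rw [mul_comm, map_mul]
    exact mul_mem_nonunits (algebraMap_mem hP hX g) h

theorem mem_iff_not_dvd_denom (hP : IsPlace K P) (hX : RatFunc.X ∈ P) {π : K[X]}
    (hπ : Irreducible π) (h : algebraMap K[X] (RatFunc K) π ∈ P.nonunits) (y : RatFunc K) :
    y ∈ P ↔ ¬ π ∣ y.denom := by
  have hy := RatFunc.num_div_denom y
  have hd0 : algebraMap K[X] (RatFunc K) y.denom ≠ 0 := by simp [RatFunc.denom_ne_zero]
  constructor
  · intro hmem hdvd
    have h1 := mul_mem_nonunits hmem ((mem_nonunits_iff_dvd hP hX hπ h _).2 hdvd)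
    nth_rw 1 [← hy] at h1
    rw [div_mul_cancel₀ _ hd0, mem_nonunits_iff_dvd hP hX hπ h] at h1
    exact hπ.not_isUnit ((RatFunc.isCoprime_num_denom y).isUnit_of_dvd' h1 hdvd)
  · intro hnd
    rw [← mem_nonunits_iff_dvd hP hX hπ h] at hnd
    rw [← hy, div_eq_mul_inv]
    refine P.mul_mem _ _ (algebraMap_mem hP hX _) ?_
    by_contra hn
    exact hnd (by simpa using mem_nonunits_of_notMem hn)

theorem eq_of_common_prime (hP : IsPlace K P) (hX : RatFunc.X ∈ P) (hP' : IsPlace K P')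
    (hX' : RatFunc.X ∈ P') {π : K[X]} (hπ : Irreducible π)
    (h : algebraMap K[X] (RatFunc K) π ∈ P.nonunits)
    (h' : algebraMap K[X] (RatFunc K) π ∈ P'.nonunits) : P = P' :=
  SetLike.ext fun y => by
    rw [mem_iff_not_dvd_denom hP hX hπ h, mem_iff_not_dvd_denom hP' hX' hπ h']

theorem hasValue_X_iff {α : K} :
    HasValue P RatFunc.X α ↔ algebraMap K[X] (RatFunc K) (X - C α) ∈ P.nonunits := by
  rw [HasValue, map_sub, RatFunc.algebraMap_X, RatFunc.algebraMap_C, RatFunc.algebraMap_eq_C]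

theorem eq_of_hasValue_X (hP : IsPlace K P) (hP' : IsPlace K P') {α : K}
    (h : HasValue P RatFunc.X α) (h' : HasValue P' RatFunc.X α) : P = P' :=
  eq_of_common_prime hP (h.mem hP) hP' (h'.mem hP') (irreducible_X_sub_C α)
    (hasValue_X_iff.1 h) (hasValue_X_iff.1 h')

theorem isRational_of_hasValue_X (hP : IsPlace K P) {α : K} (h : HasValue P RatFunc.X α) :
    IsRational K P := by
  intro y hy
  rw [mem_iff_not_dvd_denom hP (h.mem hP) (irreducible_X_sub_C α) (hasValue_X_iff.1 h),
    dvd_iff_isRoot, IsRoot.def] at hy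
  refine ⟨y.num.eval α / y.denom.eval α, ?_⟩
  rw [← RatFunc.num_div_denom y]
  simpa using (h.polynomial hP y.num).div hP (h.polynomial hP y.denom) hy

theorem exists_place (α : K) : ∃ P : ValuationSubring (RatFunc K),
    IsPlace K P ∧ HasValue P RatFunc.X α := by
  let v : IsDedekindDomain.HeightOneSpectrum K[X] :=
    ⟨Ideal.span {X - C α}, (Ideal.span_singleton_prime (X_sub_C_ne_zero α)).2
      (prime_X_sub_C α), by simpa using X_sub_C_ne_zero α⟩
  have hX : HasValue (v.valuation (RatFunc K)).valuationSubring RatFunc.X α := by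
    rw [hasValue_X_iff, ValuationSubring.mem_nonunits_iff_or]
    right
    rw [Valuation.mem_valuationSubring_iff, map_inv₀, not_le]
    have h0 : algebraMap K[X] (RatFunc K) (X - C α) ≠ 0 :=
      (map_ne_zero_iff _ (RatFunc.algebraMap_injective K)).2 (X_sub_C_ne_zero α)
    refine (one_lt_inv₀ (zero_lt_iff.2 (by simpa using h0))).2 ?_
    rw [IsDedekindDomain.HeightOneSpectrum.valuation_lt_one_iff_mem]
    exact Ideal.mem_span_singleton_self _
  refine ⟨_, ⟨fun c => ?_, fun h => ?_⟩, hX⟩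
  · rw [Valuation.mem_valuationSubring_iff,
      IsScalarTower.algebraMap_apply K K[X] (RatFunc K)]
    exact v.valuation_le_one _
  · rw [hasValue_X_iff, h] at hX
    exact notMem_of_mem_nonunits hX
      ((map_ne_zero_iff _ (RatFunc.algebraMap_injective K)).2 (X_sub_C_ne_zero α))
      (ValuationSubring.mem_top _)

theorem exists_irreducible_mem_nonunits (hP : IsPlace K P) (hX : RatFunc.X ∈ P) :
    ∃ π : K[X], π.Monic ∧ Irreducible π ∧ algebraMap K[X] (RatFunc K) π ∈ P.nonunits := by
  obtain ⟨f, hf0, hf⟩ : ∃ f : K[X], f ≠ 0 ∧ algebraMap K[X] (RatFunc K) f ∈ P.nonunits := by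
    by_contra! hcon
    refine hP.2 (top_unique fun y _ => ?_)
    rw [← RatFunc.num_div_denom y, div_eq_mul_inv]
    refine P.mul_mem _ _ (algebraMap_mem hP hX _) ?_
    by_contra hn
    exact hcon _ (RatFunc.denom_ne_zero y) (by simpa using mem_nonunits_of_notMem hn)
  induction f using UniqueFactorizationMonoid.induction_on_prime with
  | h₁ => exact absurd rfl hf0
  | h₂ f hu =>
    obtain ⟨c, hc, rfl⟩ := Polynomial.isUnit_iff.1 hu
    exact absurd hf (by
      rw [RatFunc.algebraMap_C, ← RatFunc.algebraMap_eq_C]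
      exact hP.algebraMap_notMem_nonunits hc.ne_zero)
  | h₃ f q hf0' hq ih =>
    by_cases h : algebraMap K[X] (RatFunc K) q ∈ P.nonunits
    · refine ⟨q * C q.leadingCoeff⁻¹, monic_mul_leadingCoeff_inv hq.ne_zero,
        (irreducible_mul_leadingCoeff_inv).2 hq.irreducible, ?_⟩
      rw [mul_comm, map_mul]
      exact mul_mem_nonunits (algebraMap_mem hP hX _) h
    · refine ih hf0' ?_
      have hinv : (algebraMap K[X] (RatFunc K) q)⁻¹ ∈ P := by
        by_contra hn
        exact h (by simpa using mem_nonunits_of_notMem hn)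
      have := mul_mem_nonunits hinv hf
      rwa [map_mul, inv_mul_cancel_left₀ (by simpa using hq.ne_zero)] at this

/-- As many places in the zero set of a polynomial as its degree: one of them is rational, since the
degrees of the places add up to at most the degree of the polynomial. -/
theorem exists_hasValue_X_of_card (S : Finset (ValuationSubring (RatFunc K))) {W : K[X]}
    (hW : W ≠ 0) (hS : ∀ P ∈ S, IsPlace K P ∧ RatFunc.X ∈ P ∧
      algebraMap K[X] (RatFunc K) W ∈ P.nonunits) (hcard : W.natDegree ≤ S.card)
    (hne : S.Nonempty) : ∃ P ∈ S, ∃ α : K, HasValue P RatFunc.X α := by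
  have hex : ∀ P : ValuationSubring (RatFunc K), ∃ π : K[X], P ∈ S → π.Monic ∧ Irreducible π ∧
      algebraMap K[X] (RatFunc K) π ∈ P.nonunits := by
    intro P
    by_cases h : P ∈ S
    · obtain ⟨π, hπ⟩ := exists_irreducible_mem_nonunits (hS P h).1 (hS P h).2.1
      exact ⟨π, fun _ => hπ⟩
    · exact ⟨0, fun h' => absurd h' h⟩
  choose π hπ using hex
  have hdvd : ∏ P ∈ S, π P ∣ W := by
    refine Finset.prod_dvd_of_coprime ?_ fun P hP => ?_
    · intro P hP P' hP' hne
      refine ((hπ P hP).2.1.coprime_iff_not_dvd).2 fun h => hne ?_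
      exact eq_of_common_prime (hS P hP).1 (hS P hP).2.1 (hS P' hP').1 (hS P' hP').2.1
        (hπ P' hP').2.1 ((mem_nonunits_iff_dvd (hS P hP).1 (hS P hP).2.1 (hπ P hP).2.1
          (hπ P hP).2.2 _).2 h) (hπ P' hP').2.2
    · exact (mem_nonunits_iff_dvd (hS P hP).1 (hS P hP).2.1 (hπ P hP).2.1
          (hπ P hP).2.2 _).1 (hS P hP).2.2
  have hdeg := natDegree_le_of_dvd hdvd hW
  rw [natDegree_prod_of_monic _ _ fun P hP => (hπ P hP).1] at hdeg
  by_contra! hcon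
  have h2 : ∀ P ∈ S, 2 ≤ (π P).natDegree := by
    intro P hP
    by_contra! hlt
    have h1 : (π P).natDegree = 1 := by
      have := (hπ P hP).2.1.natDegree_pos
      omega
    have h3 := (hπ P hP).1.eq_X_add_C h1
    refine hcon P hP (-(π P).coeff 0) ?_
    rw [hasValue_X_iff, C_neg, sub_neg_eq_add, ← h3]
    exact (hπ P hP).2.2
  have h3 := Finset.card_nsmul_le_sum S (fun P => (π P).natDegree) 2 h2
  have := hne.card_pos
  simp only [smul_eq_mul] at h3
  omega

/-- The place `P ∘ τ`, at which `y` behaves as `τ y` does at `P`. This is a right action of the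
automorphisms on the places. -/
noncomputable def pullback (τ : RatFunc K ≃ₐ[K] RatFunc K) (P : ValuationSubring (RatFunc K)) :
    ValuationSubring (RatFunc K) :=
  P.comap ((τ : RatFunc K →ₐ[K] RatFunc K) : RatFunc K →+* RatFunc K)

variable {τ τ' : RatFunc K ≃ₐ[K] RatFunc K}

theorem mem_pullback {y : RatFunc K} : y ∈ pullback τ P ↔ τ y ∈ P := Iff.rfl

theorem hasValue_pullback {y : RatFunc K} {c : K} :
    HasValue (pullback τ P) y c ↔ HasValue P (τ y) c :=
  hasValue_comap (τ : RatFunc K →ₐ[K] RatFunc K)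

theorem pullback_mul : pullback (τ * τ') P = pullback τ' (pullback τ P) := rfl

theorem pullback_one : pullback 1 P = P := rfl

theorem pullback_inv_pullback : pullback τ⁻¹ (pullback τ P) = P := by
  rw [← pullback_mul, mul_inv_cancel, pullback_one]

theorem pullback_injective : Function.Injective (pullback τ) := fun P P' h => by
  rw [← pullback_inv_pullback (τ := τ) (P := P), h, pullback_inv_pullback]

theorem IsPlace.pullback (hP : IsPlace K P) : IsPlace K (pullback τ P) := by
  refine ⟨fun c => ?_, fun h => hP.2 (top_unique fun y _ => ?_)⟩
  · rw [mem_pullback, AlgEquiv.commutes]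
    exact hP.1 c
  · have : τ.symm y ∈ GFFT.pullback τ P := by rw [h]; exact ValuationSubring.mem_top _
    simpa [mem_pullback] using this

theorem IsRational.pullback (hP : IsRational K P) : IsRational K (pullback τ P) := fun y hy => by
  obtain ⟨c, hc⟩ := hP (τ y) hy
  exact ⟨c, hasValue_pullback.2 hc⟩

end RatFunc

/-! ### Powers of the primitive element -/

section PrimitiveElement

variable {K : Type u} [Field K]

/-- The coordinates of `θ ^ k` in the basis `1, θ`, for a root `θ` of `x² + a x + b`. -/
def powCoeff (a b : K) : ℕ → K × K
  | 0 => (1, 0)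
  | k + 1 => (-b * (powCoeff a b k).2, (powCoeff a b k).1 - a * (powCoeff a b k).2)

/-- The linear polynomial `s x + t`, where `θ ^ k = s + t θ`. -/
noncomputable def powLin (a b : K) (k : ℕ) : K[X] :=
  C (powCoeff a b k).1 * X + C (powCoeff a b k).2

theorem pow_eq_powCoeff {L : Type*} [Field L] [Algebra K L] {a b : K} {θ : L}
    (hθ : θ ^ 2 + algebraMap K L a * θ + algebraMap K L b = 0) (k : ℕ) :
    θ ^ k = algebraMap K L (powCoeff a b k).1 + algebraMap K L (powCoeff a b k).2 * θ := by
  induction k with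
  | zero => simp [powCoeff]
  | succ k ih =>
    rw [pow_succ, ih]
    simp only [powCoeff, map_mul, map_sub, map_neg]
    linear_combination (algebraMap K L (powCoeff a b k).2) * hθ

variable [Fintype K] {a b : K}

/-- The extension field generated by a root `θ` of the primitive polynomial, with `1, θ` independent
over `K`. -/
theorem exists_primitive_element
    (hm : IsPrimitiveOverFinite (X ^ 2 + C a * X + C b : K[X])) :
    ∃ (L : Type u) (_ : Field L) (_ : Algebra K L) (θ : L),
      θ ^ 2 + algebraMap K L a * θ + algebraMap K L b = 0 ∧
      orderOf θ = (Fintype.card K + 1) * (Fintype.card K - 1) ∧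
      ∀ c d : K, algebraMap K L c + algebraMap K L d * θ = 0 → c = 0 ∧ d = 0 := by
  obtain ⟨hmon, hirr, hord⟩ := hm
  have hdeg : (X ^ 2 + C a * X + C b : K[X]).natDegree = 2 := by compute_degree!
  have hroot := AdjoinRoot.eval₂_root (X ^ 2 + C a * X + C b : K[X])
  rw [eval₂_add, eval₂_add, eval₂_mul, eval₂_pow, eval₂_X, eval₂_C, eval₂_C] at hroot
  generalize (X ^ 2 + C a * X + C b : K[X]) = m at *
  have : Fact (Irreducible m) := ⟨hirr⟩
  refine ⟨AdjoinRoot m, inferInstance, inferInstance, AdjoinRoot.root m, hroot, ?_, ?_⟩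
  · rw [hord, hdeg, ← Nat.sq_sub_sq, one_pow]
  · intro c d h
    have h1 : AdjoinRoot.mk m (C d * X + C c) = 0 := by
      rw [map_add, map_mul, AdjoinRoot.mk_C, AdjoinRoot.mk_C, AdjoinRoot.mk_X, add_comm]
      exact h
    have h2 : (C d * X + C c : K[X]) = 0 := by
      by_contra hne
      refine AdjoinRoot.mk_ne_zero_of_natDegree_lt hmon hne ?_ h1
      rw [hdeg]
      exact lt_of_le_of_lt natDegree_linear_le (by norm_num)
    have h3 := congrArg (fun f => f.coeff 0) h2
    have h4 := congrArg (fun f => f.coeff 1) h2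
    simp at h3 h4
    exact ⟨h3, h4⟩

/-- The power `θ ^ k` lies in the base field exactly when `q + 1` divides `k`. -/
theorem powCoeff_snd_eq_zero_iff (hm : IsPrimitiveOverFinite (X ^ 2 + C a * X + C b : K[X]))
    (k : ℕ) : (powCoeff a b k).2 = 0 ↔ Fintype.card K + 1 ∣ k := by
  obtain ⟨L, _, _, θ, hθ, hord, hind⟩ := exists_primitive_element hm
  have hq : 0 < Fintype.card K - 1 := Nat.sub_pos_of_lt Fintype.one_lt_card
  have hθ0 : θ ≠ 0 := by
    intro h
    exact one_ne_zero (hind 0 1 (by simpa using h)).2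
  have hk := pow_eq_powCoeff hθ k
  constructor
  · intro h
    rw [h, map_zero, zero_mul, add_zero] at hk
    have hs : (powCoeff a b k).1 ≠ 0 := by
      intro h0
      rw [h0, map_zero] at hk
      exact pow_ne_zero k hθ0 hk
    have h1 : θ ^ (k * (Fintype.card K - 1)) = 1 := by
      rw [pow_mul, hk, ← map_pow, FiniteField.pow_card_sub_one_eq_one _ hs, map_one]
    rw [← orderOf_dvd_iff_pow_eq_one, hord] at h1
    exact Nat.dvd_of_mul_dvd_mul_right hq h1
  · intro h
    have h1 : θ ^ (k * (Fintype.card K - 1)) = 1 := by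
      rw [← orderOf_dvd_iff_pow_eq_one, hord]
      exact Nat.mul_dvd_mul_right h _
    have h2 : (θ ^ k) ^ Fintype.card K - θ ^ k = 0 := by
      rw [pow_mul] at h1
      have : Fintype.card K = (Fintype.card K - 1) + 1 := by omega
      rw [this, pow_succ, h1, one_mul, sub_self]
    have h3 : (X : K[X]) ^ Fintype.card K - X = ∏ c : K, (X - C c) := by
      have h5 := FiniteField.roots_X_pow_card_sub_X K
      have h6 := prod_multiset_X_sub_C_of_monic_of_roots_card_eq
        (p := (X : K[X]) ^ Fintype.card K - X)
        (monic_X_pow_sub (by rw [degree_X]; exact_mod_cast Fintype.one_lt_card)) (by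
          rw [h5, FiniteField.X_pow_card_sub_X_natDegree_eq K Fintype.one_lt_card]
          rfl)
      rw [← h6, h5]
      rfl
    have h4 := congrArg (Polynomial.aeval (θ ^ k)) h3
    simp only [map_sub, map_pow, aeval_X, map_prod, aeval_C, h2] at h4
    obtain ⟨c, -, hc⟩ := Finset.prod_eq_zero_iff.1 h4.symm
    refine (hind ((powCoeff a b k).1 - c) _ ?_).2
    rw [← hc, hk, map_sub]
    ring

theorem powLin_ne_zero (hm : IsPrimitiveOverFinite (X ^ 2 + C a * X + C b : K[X])) (k : ℕ) :
    powLin a b k ≠ 0 := by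
  obtain ⟨L, _, _, θ, hθ, hord, hind⟩ := exists_primitive_element hm
  intro h
  have hs : (powCoeff a b k).1 = 0 := by simpa [powLin] using congrArg (fun f => f.coeff 1) h
  have ht : (powCoeff a b k).2 = 0 := by simpa [powLin] using congrArg (fun f => f.coeff 0) h
  have hk := pow_eq_powCoeff hθ k
  rw [hs, ht, map_zero, zero_mul, add_zero] at hk
  have h0 : θ = 0 := by
    by_contra h0
    exact pow_ne_zero k h0 hk
  exact one_ne_zero (hind 0 1 (by simpa using h0)).2

/-- A `K`-rational fixed point of the Möbius transformation belonging to `θ ^ k` is an eigenvector of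
multiplication by `θ ^ k`, hence exists only if `θ ^ k` is a scalar. -/
theorem powCoeff_snd_eq_zero_of_fixed
    (hm : IsPrimitiveOverFinite (X ^ 2 + C a * X + C b : K[X])) {k : ℕ} {α : K}
    (h : (powLin a b k).eval α = α * (powLin a b (k + 1)).eval α) : (powCoeff a b k).2 = 0 := by
  obtain ⟨L, _, _, θ, hθ, hord, hind⟩ := exists_primitive_element hm
  have h0 := pow_eq_powCoeff hθ k
  have h1 := pow_eq_powCoeff hθ (k + 1)
  have h2 : (powCoeff a b k).1 * α + (powCoeff a b k).2 =
      α * ((powCoeff a b (k + 1)).1 * α + (powCoeff a b (k + 1)).2) := by simpa [powLin] using h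
  generalize (powCoeff a b k).1 = s at *
  generalize (powCoeff a b k).2 = t at *
  generalize (powCoeff a b (k + 1)).1 = s' at *
  generalize (powCoeff a b (k + 1)).2 = t' at *
  set i := algebraMap K L
  have h3 : i s * i α + i t = i α * (i s' * i α + i t') := by
    simpa using congrArg i h2
  have h4 : (i s - i α * i s' - θ ^ k) * (1 - i α * θ) = 0 := by
    rw [pow_succ] at h1
    linear_combination i α * h1 - h0 - θ * h3
  have h5 : (1 - i α * θ) ≠ 0 := by
    intro h5
    exact one_ne_zero (hind 1 (-α) (by rw [map_one, map_neg, ← h5]; ring)).1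
  have h6 := (mul_eq_zero.1 h4).resolve_right h5
  rw [h0] at h6
  exact neg_eq_zero.1 (hind (-α * s') (-t) (by
    rw [← h6, map_mul, map_neg, map_neg]; ring)).2

theorem constCoeff_ne_zero (hm : IsPrimitiveOverFinite (X ^ 2 + C a * X + C b : K[X])) :
    b ≠ 0 := by
  obtain ⟨L, _, _, θ, hθ, hord, hind⟩ := exists_primitive_element hm
  rintro rfl
  have h : θ * (θ + algebraMap K L a) = 0 := by
    rw [map_zero] at hθ
    linear_combination hθ
  rcases mul_eq_zero.1 h with h | h
  · exact one_ne_zero (hind 0 1 (by simpa using h)).2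
  · exact one_ne_zero (hind a 1 (by rw [map_one, ← h]; ring)).2

end PrimitiveElement

/-! ### The automorphism and its powers -/

section Automorphism

variable {K : Type u} [Field K] {a b : K} {σ : RatFunc K ≃ₐ[K] RatFunc K}

theorem algEquiv_ext {τ τ' : RatFunc K ≃ₐ[K] RatFunc K} (h : τ RatFunc.X = τ' RatFunc.X) :
    τ = τ' := by
  ext y
  rw [← RatFunc.num_div_denom y]
  simp only [map_div₀, algebraMap_eq_aeval]
  simp only [← Polynomial.aeval_algHom_apply, h]

theorem algEquiv_C (τ : RatFunc K ≃ₐ[K] RatFunc K) (c : K) : τ (RatFunc.C c) = RatFunc.C c := by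
  rw [← RatFunc.algebraMap_eq_C]
  exact τ.commutes c

theorem denominator_ne_zero (hσ : σ RatFunc.X = 1 / (-RatFunc.C b * RatFunc.X - RatFunc.C a)) :
    (-RatFunc.C b * RatFunc.X - RatFunc.C a : RatFunc K) ≠ 0 := by
  intro h
  rw [h, div_zero] at hσ
  exact RatFunc.X_ne_zero (by simpa using hσ)

theorem sigma_powLin (hσ : σ RatFunc.X = 1 / (-RatFunc.C b * RatFunc.X - RatFunc.C a)) (k : ℕ) :
    σ (algebraMap K[X] (RatFunc K) (powLin a b k)) *
      (-RatFunc.C b * RatFunc.X - RatFunc.C a) =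
      algebraMap K[X] (RatFunc K) (powLin a b (k + 1)) := by
  have h0 := denominator_ne_zero hσ
  simp only [powLin, powCoeff, map_add, map_mul, RatFunc.algebraMap_X, RatFunc.algebraMap_C,
    algEquiv_C, hσ, map_sub, map_neg]
  generalize hw : (-RatFunc.C b * RatFunc.X - RatFunc.C a : RatFunc K) = w at *
  field_simp
  rw [← hw]
  ring

/-- `σ ^ k` is the Möbius transformation `x ↦ Lₖ / Lₖ₊₁`, with `Lₖ` the polynomial `powLin a b k`. -/
theorem sigma_pow_X (hσ : σ RatFunc.X = 1 / (-RatFunc.C b * RatFunc.X - RatFunc.C a)) (k : ℕ) :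
    (σ ^ k) RatFunc.X * algebraMap K[X] (RatFunc K) (powLin a b (k + 1)) =
      algebraMap K[X] (RatFunc K) (powLin a b k) := by
  induction k with
  | zero => simp [powLin, powCoeff]
  | succ k ih =>
    rw [pow_succ', AlgEquiv.mul_apply, ← sigma_powLin hσ (k + 1), ← mul_assoc, ← map_mul, ih,
      sigma_powLin hσ]

variable [Fintype K]

/-- The roots of `Q` are the fixed points of `σ`, so `σ ^ k` changes `Q` only by a constant and the
square of the denominator. -/
theorem sigma_pow_quadQ (hm : IsPrimitiveOverFinite (X ^ 2 + C a * X + C b : K[X]))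
    (hσ : σ RatFunc.X = 1 / (-RatFunc.C b * RatFunc.X - RatFunc.C a)) (k : ℕ) :
    (σ ^ k) (quadQ a b) * algebraMap K[X] (RatFunc K) (powLin a b (k + 1)) ^ 2 =
      RatFunc.C b ^ k * quadQ a b := by
  have h0 := denominator_ne_zero hσ
  have hb : (RatFunc.C b : RatFunc K) ≠ 0 := by simpa using constCoeff_ne_zero hm
  induction k with
  | zero => simp [powLin, powCoeff]
  | succ k ih =>
    have h1 : σ (quadQ a b) * (-RatFunc.C b * RatFunc.X - RatFunc.C a) ^ 2 =
        RatFunc.C b * quadQ a b := by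
      simp only [quadQ, map_add, map_mul, map_pow, algEquiv_C, hσ, map_div₀, map_one]
      generalize hw : (-RatFunc.C b * RatFunc.X - RatFunc.C a : RatFunc K) = w at *
      field_simp
      rw [← hw]
      ring
    rw [pow_succ', AlgEquiv.mul_apply, ← sigma_powLin hσ (k + 1), mul_pow, ← mul_assoc, ← map_pow,
      ← map_mul, ih, map_mul, map_pow, algEquiv_C, mul_assoc, h1]
    ring

/-- No power of `σ` other than the identity fixes a rational place. -/
theorem sigma_pow_free (hm : IsPrimitiveOverFinite (X ^ 2 + C a * X + C b : K[X]))
    (hσ : σ RatFunc.X = 1 / (-RatFunc.C b * RatFunc.X - RatFunc.C a)) {k : ℕ}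
    {P : ValuationSubring (RatFunc K)} (hP : IsPlace K P) {α : K} (hα : HasValue P RatFunc.X α)
    (hfix : pullback (σ ^ k) P = P) : (powCoeff a b k).2 = 0 := by
  refine powCoeff_snd_eq_zero_of_fixed hm (α := α) ?_
  have h1 : HasValue P ((σ ^ k) RatFunc.X) α := by
    rw [← hasValue_pullback, hfix]
    exact hα
  have h2 := h1.mul hP (hα.polynomial hP (powLin a b (k + 1)))
  rw [sigma_pow_X hσ] at h2
  exact (hα.polynomial hP _).unique hP h2

theorem sigma_pow_eq_one_iff (hm : IsPrimitiveOverFinite (X ^ 2 + C a * X + C b : K[X]))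
    (hσ : σ RatFunc.X = 1 / (-RatFunc.C b * RatFunc.X - RatFunc.C a)) (k : ℕ) :
    σ ^ k = 1 ↔ (powCoeff a b k).2 = 0 := by
  constructor
  · intro h
    obtain ⟨P, hP, h0⟩ := exists_place (0 : K)
    exact sigma_pow_free hm hσ hP h0 (by rw [h, pullback_one])
  · intro h
    refine algEquiv_ext ?_
    have h1 := sigma_pow_X hσ k
    have h2 : (powCoeff a b k).1 ≠ 0 := fun h2 => powLin_ne_zero hm k (by simp [powLin, h, h2])
    have h3 : (RatFunc.C (powCoeff a b k).1 : RatFunc K) ≠ 0 := by simpa using h2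
    simp only [powLin, powCoeff, h, map_mul, RatFunc.algebraMap_X, RatFunc.algebraMap_C,
      mul_zero, map_zero, zero_mul, zero_add, sub_zero, add_zero] at h1
    rw [mul_comm] at h1
    simpa using mul_left_cancel₀ h3 h1

theorem orderOf_sigma (hm : IsPrimitiveOverFinite (X ^ 2 + C a * X + C b : K[X]))
    (hσ : σ RatFunc.X = 1 / (-RatFunc.C b * RatFunc.X - RatFunc.C a)) :
    orderOf σ = Fintype.card K + 1 := by
  have h : ∀ k, orderOf σ ∣ k ↔ Fintype.card K + 1 ∣ k := fun k => by
    rw [orderOf_dvd_iff_pow_eq_one, sigma_pow_eq_one_iff hm hσ, powCoeff_snd_eq_zero_iff hm]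
  exact Nat.dvd_antisymm ((h _).2 dvd_rfl) ((h _).1 dvd_rfl)

theorem exists_pow_eq (hm : IsPrimitiveOverFinite (X ^ 2 + C a * X + C b : K[X]))
    (hσ : σ RatFunc.X = 1 / (-RatFunc.C b * RatFunc.X - RatFunc.C a))
    {τ : RatFunc K ≃ₐ[K] RatFunc K} (hτ : τ ∈ Subgroup.zpowers σ) : ∃ k : ℕ, σ ^ k = τ := by
  have hfin : IsOfFinOrder σ := by
    rw [← orderOf_pos_iff, orderOf_sigma hm hσ]
    exact Nat.succ_pos _
  exact hfin.mem_powers_iff_mem_zpowers.2 hτ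

/-- `σ x = 1 / (-b x - a)` vanishes at the pole of `x`. -/
theorem hasValue_pullback_sigma (hm : IsPrimitiveOverFinite (X ^ 2 + C a * X + C b : K[X]))
    (hσ : σ RatFunc.X = 1 / (-RatFunc.C b * RatFunc.X - RatFunc.C a))
    {P : ValuationSubring (RatFunc K)} (hP : IsPlace K P) (hX : RatFunc.X ∉ P) :
    HasValue (pullback σ P) RatFunc.X (0 : K) := by
  rw [hasValue_pullback, hasValue_zero_iff, hσ, one_div]
  refine mem_nonunits_of_notMem fun h => hX ?_
  have hC : ∀ c : K, RatFunc.C c ∈ P := fun c => by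
    rw [← RatFunc.algebraMap_eq_C]
    exact hP.1 c
  have h1 := P.mul_mem _ _ (hC (-b⁻¹)) (P.add_mem _ _ h (hC a))
  have hb : (RatFunc.C b : RatFunc K) ≠ 0 := by simpa using constCoeff_ne_zero hm
  convert h1 using 1
  rw [map_neg, map_inv₀]
  field_simp
  ring

/-- The pole of `x` is unique. -/
theorem eq_of_X_notMem (hm : IsPrimitiveOverFinite (X ^ 2 + C a * X + C b : K[X]))
    (hσ : σ RatFunc.X = 1 / (-RatFunc.C b * RatFunc.X - RatFunc.C a))
    {P P' : ValuationSubring (RatFunc K)} (hP : IsPlace K P) (hX : RatFunc.X ∉ P)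
    (hP' : IsPlace K P') (hX' : RatFunc.X ∉ P') : P = P' :=
  pullback_injective (τ := σ) (eq_of_hasValue_X hP.pullback hP'.pullback
    (hasValue_pullback_sigma hm hσ hP hX) (hasValue_pullback_sigma hm hσ hP' hX'))

theorem isRational_of_X_notMem (hm : IsPrimitiveOverFinite (X ^ 2 + C a * X + C b : K[X]))
    (hσ : σ RatFunc.X = 1 / (-RatFunc.C b * RatFunc.X - RatFunc.C a))
    {P : ValuationSubring (RatFunc K)} (hP : IsPlace K P) (hX : RatFunc.X ∉ P) :
    IsRational K P := by
  have h := isRational_of_hasValue_X hP.pullback (hasValue_pullback_sigma hm hσ hP hX)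
  have := h.pullback (τ := σ⁻¹)
  rwa [pullback_inv_pullback] at this

/-- The group `⟨σ⟩` acts freely on the rational places. -/
theorem eq_one_of_pullback_eq (hm : IsPrimitiveOverFinite (X ^ 2 + C a * X + C b : K[X]))
    (hσ : σ RatFunc.X = 1 / (-RatFunc.C b * RatFunc.X - RatFunc.C a))
    {τ : RatFunc K ≃ₐ[K] RatFunc K} (hτ : τ ∈ Subgroup.zpowers σ)
    {P : ValuationSubring (RatFunc K)} (hP : IsPlace K P) (hPr : IsRational K P)
    (hfix : pullback τ P = P) : τ = 1 := by
  obtain ⟨k, rfl⟩ := exists_pow_eq hm hσ hτ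
  rw [sigma_pow_eq_one_iff hm hσ]
  by_cases hX : RatFunc.X ∈ P
  · obtain ⟨α, hα⟩ := hPr _ hX
    exact sigma_pow_free hm hσ hP hα hfix
  · refine sigma_pow_free hm hσ hP.pullback (hasValue_pullback_sigma hm hσ hP hX) ?_
    rw [← pullback_mul, ← pow_succ', pow_succ, pullback_mul, hfix]

theorem eq_of_pullback_eq (hm : IsPrimitiveOverFinite (X ^ 2 + C a * X + C b : K[X]))
    (hσ : σ RatFunc.X = 1 / (-RatFunc.C b * RatFunc.X - RatFunc.C a))
    {τ τ' : RatFunc K ≃ₐ[K] RatFunc K} (hτ : τ ∈ Subgroup.zpowers σ)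
    (hτ' : τ' ∈ Subgroup.zpowers σ)
    {P : ValuationSubring (RatFunc K)} (hP : IsPlace K P) (hPr : IsRational K P)
    (h : pullback τ P = pullback τ' P) : τ = τ' := by
  rw [← mul_inv_eq_one]
  refine eq_one_of_pullback_eq hm hσ (mul_mem hτ (inv_mem hτ')) hP hPr ?_
  rw [pullback_mul, h, pullback_inv_pullback]

/-- The partial fraction of `τ x` for `τ ≠ 1` in `⟨σ⟩`, and the effect of `τ` on `1 / Q`. -/
theorem exists_moebius (hm : IsPrimitiveOverFinite (X ^ 2 + C a * X + C b : K[X]))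
    (hσ : σ RatFunc.X = 1 / (-RatFunc.C b * RatFunc.X - RatFunc.C a))
    {τ : RatFunc K ≃ₐ[K] RatFunc K} (hτ : τ ∈ Subgroup.zpowers σ) (h1 : τ ≠ 1) :
    ∃ α β γ d : K, β ≠ 0 ∧ d ≠ 0 ∧
      τ RatFunc.X = RatFunc.C γ + RatFunc.C β / (RatFunc.X - RatFunc.C α) ∧
      τ (1 / quadQ a b) = RatFunc.C d * (RatFunc.X - RatFunc.C α) ^ 2 / quadQ a b := by
  obtain ⟨k, rfl⟩ := exists_pow_eq hm hσ hτ
  rw [Ne, sigma_pow_eq_one_iff hm hσ] at h1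
  have hb := constCoeff_ne_zero hm
  set s := (powCoeff a b k).1 with hs
  set t := (powCoeff a b k).2 with ht
  have hs' : (powCoeff a b (k + 1)).1 ≠ 0 := by
    simp only [powCoeff]
    exact mul_ne_zero (neg_ne_zero.2 hb) h1
  set s' := (powCoeff a b (k + 1)).1
  set t' := (powCoeff a b (k + 1)).2
  have hS : (RatFunc.C s' : RatFunc K) ≠ 0 := by simpa using hs'
  have hα : (RatFunc.X - RatFunc.C (-t' / s') : RatFunc K) ≠ 0 := by
    rw [← RatFunc.algebraMap_X, ← RatFunc.algebraMap_C, ← map_sub]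
    exact (map_ne_zero_iff _ (RatFunc.algebraMap_injective K)).2 (X_sub_C_ne_zero _)
  have hL' : algebraMap K[X] (RatFunc K) (powLin a b (k + 1)) =
      RatFunc.C s' * (RatFunc.X - RatFunc.C (-t' / s')) := by
    simp only [powLin, map_add, map_mul, RatFunc.algebraMap_X, RatFunc.algebraMap_C, map_div₀,
      map_neg]
    field_simp
    ring
  have hX : (σ ^ k) RatFunc.X = RatFunc.C (s / s') +
      RatFunc.C ((t - s * t' / s') / s') / (RatFunc.X - RatFunc.C (-t' / s')) := by
    have h2 := sigma_pow_X hσ k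
    rw [hL'] at h2
    rw [eq_div_of_mul_eq (mul_ne_zero hS hα) h2]
    simp only [powLin, map_add, map_mul, RatFunc.algebraMap_X, RatFunc.algebraMap_C]
    rw [← hs, ← ht]
    have hXv : RatFunc.X = (RatFunc.X - RatFunc.C (-t' / s')) + RatFunc.C (-t' / s') := by ring
    generalize (RatFunc.X - RatFunc.C (-t' / s') : RatFunc K) = v at *
    rw [hXv]
    simp only [map_div₀, map_neg, map_sub, map_mul]
    field_simp
    ring
  have hQ : (σ ^ k) (1 / quadQ a b) =
      RatFunc.C (s' ^ 2 / b ^ k) * (RatFunc.X - RatFunc.C (-t' / s')) ^ 2 / quadQ a b := by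
    have h2 := sigma_pow_quadQ hm hσ k
    rw [hL'] at h2
    have hB : (RatFunc.C b : RatFunc K) ≠ 0 := by simpa using hb
    rw [map_div₀, map_one, eq_div_of_mul_eq (pow_ne_zero 2 (mul_ne_zero hS hα)) h2, one_div_div,
      mul_pow]
    generalize (RatFunc.X - RatFunc.C (-t' / s') : RatFunc K) = v
    rw [map_div₀, map_pow, map_pow]
    field_simp
  refine ⟨-t' / s', (t - s * t' / s') / s', s / s', s' ^ 2 / b ^ k, ?_, ?_, hX, hQ⟩
  · intro h0
    rw [h0, map_zero, zero_div, add_zero, ← algEquiv_C (σ ^ k)] at hX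
    have h3 := (σ ^ k).injective hX
    rw [← RatFunc.algebraMap_X, ← RatFunc.algebraMap_C] at h3
    exact X_ne_C _ (RatFunc.algebraMap_injective K h3)
  · exact div_ne_zero (pow_ne_zero 2 hs') (pow_ne_zero k hb)

end Automorphism

/-! ### The trace of `x` and the norm of `1 / Q` -/

section Trace

variable {K : Type u} [Field K]

/-- The polynomial `∏ (x - α)` with the simple roots `α ∈ O`. -/
noncomputable def rootPoly (O : Finset K) : K[X] := ∏ α ∈ O, (X - C α)

theorem rootPoly_monic (O : Finset K) : (rootPoly O).Monic :=
  monic_prod_of_monic _ _ fun α _ => monic_X_sub_C α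

theorem natDegree_rootPoly (O : Finset K) : (rootPoly O).natDegree = O.card := by
  rw [rootPoly, natDegree_prod_of_monic _ _ fun α _ => monic_X_sub_C α]
  simp

theorem eval_rootPoly_eq_zero {O : Finset K} {α : K} : (rootPoly O).eval α = 0 ↔ α ∈ O := by
  rw [rootPoly, eval_prod, Finset.prod_eq_zero_iff]
  simp [sub_eq_zero]

theorem algebraMap_X_sub_C (α : K) :
    algebraMap K[X] (RatFunc K) (X - C α) = RatFunc.X - RatFunc.C α := by
  rw [map_sub, RatFunc.algebraMap_X, RatFunc.algebraMap_C]

theorem algebraMap_ne_zero {f : K[X]} (hf : f ≠ 0) : algebraMap K[X] (RatFunc K) f ≠ 0 :=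
  (map_ne_zero_iff _ (RatFunc.algebraMap_injective K)).2 hf

theorem X_sub_C_ne_zero' (α : K) : (RatFunc.X - RatFunc.C α : RatFunc K) ≠ 0 := by
  rw [← algebraMap_X_sub_C]
  exact algebraMap_ne_zero (X_sub_C_ne_zero α)

theorem quadQ_ne_zero (a b : K) : quadQ a b ≠ 0 := by
  have : quadQ a b = algebraMap K[X] (RatFunc K) (X ^ 2 + C (a / b) * X + C (1 / b)) := by
    simp only [quadQ, map_add, map_mul, map_pow, RatFunc.algebraMap_X, RatFunc.algebraMap_C]
  rw [this]
  refine algebraMap_ne_zero (Monic.ne_zero ?_)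
  monicity!

/-- The shape of the trace of `x` and the norm of `1 / Q` under a group `H` of Möbius
transformations: the trace is `U / ∏ (x - α)` with coprime numerator and denominator, the `α ∈ O`
being the conjugates of `∞` other than `∞`, and the norm is `d ∏ (x - α)² / Q ^ |H|`. -/
structure IsTraceData (a b : K) (H : Subgroup (RatFunc K ≃ₐ[K] RatFunc K)) (O : Finset K)
    (U : K[X]) (d : K) : Prop where
  card : O.card + 1 = Nat.card H
  monic : U.Monic
  natDegree : U.natDegree = Nat.card H
  eval_ne_zero : ∀ α ∈ O, U.eval α ≠ 0
  trace_eq : traceX H =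
    algebraMap K[X] (RatFunc K) U / algebraMap K[X] (RatFunc K) (rootPoly O)
  trace_notMem : ∀ P : ValuationSubring (RatFunc K), IsPlace K P → RatFunc.X ∉ P → traceX H ∉ P
  d_ne_zero : d ≠ 0
  d_eq_one : Nat.card H = 1 → d = 1
  norm_eq : normInvQ a b H = RatFunc.C d * algebraMap K[X] (RatFunc K) (rootPoly O) ^ 2 /
    quadQ a b ^ Nat.card H

namespace IsTraceData

variable {a b : K} {H : Subgroup (RatFunc K ≃ₐ[K] RatFunc K)} {O : Finset K} {U : K[X]} {d : K}
  {P : ValuationSubring (RatFunc K)}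

theorem hasValue (h : IsTraceData a b H O U d) (hP : IsPlace K P) {α : K}
    (hα : HasValue P RatFunc.X α) (hO : α ∉ O) :
    HasValue P (traceX H) (U.eval α / (rootPoly O).eval α) := by
  rw [h.trace_eq]
  exact (hα.polynomial hP U).div hP (hα.polynomial hP _) (mt eval_rootPoly_eq_zero.1 hO)

theorem notMem (h : IsTraceData a b H O U d) (hP : IsPlace K P) {α : K}
    (hα : HasValue P RatFunc.X α) (hO : α ∈ O) : traceX H ∉ P := by
  rw [h.trace_eq]
  have h1 := hα.polynomial hP (rootPoly O)
  rw [eval_rootPoly_eq_zero.2 hO, hasValue_zero_iff] at h1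
  exact div_notMem hP (hα.polynomial hP U) (h.eval_ne_zero α hO) h1
    (algebraMap_ne_zero (rootPoly_monic O).ne_zero)

theorem mem_iff (h : IsTraceData a b H O U d) (hP : IsPlace K P) {α : K}
    (hα : HasValue P RatFunc.X α) : traceX H ∈ P ↔ α ∉ O :=
  ⟨fun h1 h2 => h.notMem hP hα h2 h1, fun h1 => (h.hasValue hP hα h1).mem hP⟩

theorem finitePoles_eq (h : IsTraceData a b H O U d) : finitePoles H = O := by
  ext α
  constructor
  · rintro ⟨P, hP, hα, hn⟩
    by_contra hO
    exact hn ((h.mem_iff hP hα).2 hO)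
  · intro hO
    obtain ⟨P, hP, hα⟩ := exists_place α
    exact ⟨P, hP, hα, h.notMem hP hα hO⟩

theorem numeratorU_eq (h : IsTraceData a b H O U d) :
    numeratorU H = algebraMap K[X] (RatFunc K) U := by
  have : ∏ᶠ α ∈ finitePoles H, (RatFunc.X - RatFunc.C α) =
      algebraMap K[X] (RatFunc K) (rootPoly O) := by
    rw [h.finitePoles_eq, finprod_mem_coe_finset, rootPoly, map_prod]
    exact Finset.prod_congr rfl fun α _ => (algebraMap_X_sub_C α).symm
  rw [numeratorU, this, h.trace_eq,
    div_mul_cancel₀ _ (algebraMap_ne_zero (rootPoly_monic O).ne_zero)]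

end IsTraceData

variable [Fintype K] {a b : K} {σ : RatFunc K ≃ₐ[K] RatFunc K}

theorem finite_of_le_zpowers (hm : IsPrimitiveOverFinite (X ^ 2 + C a * X + C b : K[X]))
    (hσ : σ RatFunc.X = 1 / (-RatFunc.C b * RatFunc.X - RatFunc.C a))
    {H : Subgroup (RatFunc K ≃ₐ[K] RatFunc K)} (hH : H ≤ Subgroup.zpowers σ) :
    (H : Set (RatFunc K ≃ₐ[K] RatFunc K)).Finite := by
  have hfin : IsOfFinOrder σ := by
    rw [← orderOf_pos_iff, orderOf_sigma hm hσ]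
    exact Nat.succ_pos _
  exact (finite_zpowers.2 hfin).subset hH

/-- The poles of `τ x` are distinct for distinct `τ ≠ 1`, since two automorphisms with a common pole
`P` would move `P` to the same place. -/
theorem exists_isTraceData (hm : IsPrimitiveOverFinite (X ^ 2 + C a * X + C b : K[X]))
    (hσ : σ RatFunc.X = 1 / (-RatFunc.C b * RatFunc.X - RatFunc.C a))
    {H : Subgroup (RatFunc K ≃ₐ[K] RatFunc K)} (hH : H ≤ Subgroup.zpowers σ) :
    ∃ (O : Finset K) (U : K[X]) (d : K), IsTraceData a b H O U d := by
  classical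
  have hfin := finite_of_le_zpowers hm hσ hH
  set T := hfin.toFinset.erase 1 with hT
  have h1T : 1 ∈ hfin.toFinset := hfin.mem_toFinset.2 H.one_mem
  have hcard : T.card + 1 = Nat.card H := by
    rw [hT, Finset.card_erase_add_one h1T, ← Set.ncard_eq_toFinset_card _ hfin]
    rfl
  have hex : ∀ τ : RatFunc K ≃ₐ[K] RatFunc K, τ ∈ T → ∃ α β γ d : K, β ≠ 0 ∧ d ≠ 0 ∧
      τ RatFunc.X = RatFunc.C γ + RatFunc.C β / (RatFunc.X - RatFunc.C α) ∧
      τ (1 / quadQ a b) = RatFunc.C d * (RatFunc.X - RatFunc.C α) ^ 2 / quadQ a b := fun τ hτ =>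
    exists_moebius hm hσ (hH (hfin.mem_toFinset.1 (Finset.mem_of_mem_erase hτ)))
      (Finset.ne_of_mem_erase hτ)
  choose! α β γ d hβ hd hX hQ using hex
  have hpole : ∀ τ ∈ T, ∀ P : ValuationSubring (RatFunc K), IsPlace K P →
      HasValue P RatFunc.X (α τ) → τ RatFunc.X ∉ P := by
    intro τ hτ P hP hα
    rw [hX τ hτ, ← RatFunc.algebraMap_eq_C, add_mem_iff_right_of_mem (hP.1 _)]
    refine div_notMem hP (hasValue_algebraMap _) (hβ τ hτ) ?_ (X_sub_C_ne_zero' _)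
    rwa [hasValue_X_iff, algebraMap_X_sub_C] at hα
  have hinj : Set.InjOn α T := by
    intro τ hτ τ' hτ' he
    obtain ⟨P, hP, hα⟩ := exists_place (α τ)
    refine eq_of_pullback_eq hm hσ (hH (hfin.mem_toFinset.1 (Finset.mem_of_mem_erase hτ)))
      (hH (hfin.mem_toFinset.1 (Finset.mem_of_mem_erase hτ'))) hP
      (isRational_of_hasValue_X hP hα) (eq_of_X_notMem hm hσ hP.pullback ?_ hP.pullback ?_)
    · exact hpole τ hτ P hP hα
    · exact hpole τ' hτ' P hP (he ▸ hα)
  set D : K[X] := ∏ τ ∈ T, (X - C (α τ)) with hD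
  have hDO : rootPoly (T.image α) = D := Finset.prod_image hinj
  have hDmon : D.Monic := hDO ▸ rootPoly_monic _
  have hDdeg : D.natDegree = T.card := by
    rw [← hDO, natDegree_rootPoly, Finset.card_image_of_injOn hinj]
  have hD0 : algebraMap K[X] (RatFunc K) D ≠ 0 := algebraMap_ne_zero hDmon.ne_zero
  set c := ∑ τ ∈ T, γ τ with hc
  set W : K[X] := ∑ τ ∈ T, C (β τ) * ∏ τ' ∈ T.erase τ, (X - C (α τ')) with hW
  have hmon1 : ((X + C c) * D).Monic := (monic_X_add_C c).mul hDmon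
  have hdeg1 : ((X + C c) * D).natDegree = T.card + 1 := by
    rw [(monic_X_add_C c).natDegree_mul hDmon, natDegree_X_add_C, hDdeg, add_comm]
  have hWdeg : W.natDegree < ((X + C c) * D).natDegree := by
    rw [hdeg1]
    refine Nat.lt_succ_of_le (natDegree_sum_le_of_forall_le _ _ fun τ hτ => ?_)
    refine (natDegree_C_mul_le _ _).trans ?_
    rw [natDegree_prod_of_monic _ _ fun τ' _ => monic_X_sub_C _]
    simpa using Finset.card_le_card (Finset.erase_subset τ T)
  have htr : traceX H = RatFunc.X + ∑ τ ∈ T, (RatFunc.C (γ τ) +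
      RatFunc.C (β τ) / (RatFunc.X - RatFunc.C (α τ))) := by
    refine (finsum_mem_eq_finite_toFinset_sum (fun τ => τ RatFunc.X) hfin).trans ?_
    rw [← Finset.add_sum_erase _ _ h1T]
    exact congrArg _ (Finset.sum_congr rfl hX)
  -- the numerator is the sum of the partial fractions over the common denominator `D`
  refine ⟨T.image α, (X + C c) * D + W, ∏ τ ∈ T, d τ, ?_, ?_, ?_, ?_, ?_, ?_, ?_, ?_, ?_⟩
  · rw [Finset.card_image_of_injOn hinj, hcard]
  · exact hmon1.add_of_left (degree_lt_degree hWdeg)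
  · rw [natDegree_add_eq_left_of_natDegree_lt hWdeg, hdeg1, hcard]
  · intro x hx
    obtain ⟨τ, hτ, rfl⟩ := Finset.mem_image.1 hx
    have h0 : D.eval (α τ) = 0 := by
      rw [← hDO, eval_rootPoly_eq_zero]
      exact hx
    rw [eval_add, eval_mul, h0, mul_zero, zero_add, hW, eval_finsetSum,
      Finset.sum_eq_single_of_mem τ hτ]
    · rw [eval_mul, eval_C, eval_prod]
      refine mul_ne_zero (hβ τ hτ) (Finset.prod_ne_zero_iff.2 fun τ' hτ' => ?_)
      rw [eval_sub, eval_X, eval_C, sub_ne_zero]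
      intro he
      exact Finset.ne_of_mem_erase hτ' (hinj (Finset.mem_of_mem_erase hτ') hτ he.symm)
    · intro τ' hτ' hne
      rw [eval_mul, eval_prod, Finset.prod_eq_zero (Finset.mem_erase.2 ⟨hne.symm, hτ⟩), mul_zero]
      simp
  · rw [hDO, htr, eq_div_iff hD0, Finset.sum_add_distrib, ← add_assoc, add_mul, map_add, map_mul,
      map_add, RatFunc.algebraMap_X, RatFunc.algebraMap_C, hc, map_sum, hW, map_sum,
      Finset.sum_mul]
    congr 1
    refine Finset.sum_congr rfl fun τ hτ => ?_
    rw [hD, ← Finset.mul_prod_erase _ _ hτ, map_mul, map_mul, algebraMap_X_sub_C, ← mul_assoc,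
      div_mul_cancel₀ _ (X_sub_C_ne_zero' _), RatFunc.algebraMap_C]
  · intro P hP hXP
    rw [htr, add_comm, add_mem_iff_right_of_mem]
    · exact hXP
    · refine sum_mem fun τ hτ => ?_
      have hC : ∀ c : K, RatFunc.C c ∈ P := fun c => by
        rw [← RatFunc.algebraMap_eq_C]
        exact hP.1 c
      refine P.add_mem _ _ (hC _) ?_
      rw [div_eq_mul_inv]
      refine P.mul_mem _ _ (hC _) (mem_of_mem_nonunits (mem_nonunits_of_notMem fun h => hXP ?_))
      simpa using P.add_mem _ _ h (hC (α τ))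
  · exact Finset.prod_ne_zero_iff.2 hd
  · intro h1
    have : T = ∅ := by
      rw [← Finset.card_eq_zero]
      omega
    rw [this, Finset.prod_empty]
  · refine (finprod_mem_eq_finite_toFinset_prod (fun τ => τ (1 / quadQ a b)) hfin).trans ?_
    rw [← Finset.mul_prod_erase _ _ h1T,
      ← hT, Finset.prod_congr rfl hQ, Finset.prod_div_distrib, Finset.prod_mul_distrib,
      Finset.prod_pow, Finset.prod_const, hDO, map_prod, hD, map_prod, ← hcard]
    simp only [algebraMap_X_sub_C]
    rw [pow_succ' (quadQ a b) T.card, AlgEquiv.one_apply, div_mul_div_comm, one_mul]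

end Trace

/-! ### One step of the tower -/

section Step

variable {K : Type u} [Field K] {a b : K} {σ : RatFunc K ≃ₐ[K] RatFunc K}
  {H H' : Subgroup (RatFunc K ≃ₐ[K] RatFunc K)} {O O' : Finset K} {U U' : K[X]} {d d' : K}
  {P : ValuationSubring (RatFunc K)}

/-- A pole of the trace other than the pole of `x` is rational. -/
theorem IsTraceData.exists_hasValue_X (h : IsTraceData a b H O U d) (hP : IsPlace K P)
    (hX : RatFunc.X ∈ P) (hn : traceX H ∉ P) : ∃ α ∈ O, HasValue P RatFunc.X α := by
  obtain ⟨π, -, hπ, hmem⟩ := exists_irreducible_mem_nonunits hP hX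
  have h1 : algebraMap K[X] (RatFunc K) (rootPoly O) ∈ P.nonunits := by
    rw [ValuationSubring.mem_nonunits_iff_or]
    right
    intro hinv
    rw [h.trace_eq, div_eq_mul_inv] at hn
    exact hn (P.mul_mem _ _ (algebraMap_mem hP hX _) hinv)
  rw [mem_nonunits_iff_dvd hP hX hπ hmem, rootPoly] at h1
  obtain ⟨α, hα, hdvd⟩ := (hπ.prime.dvd_finsetProd_iff _).1 h1
  exact ⟨α, hα, hasValue_X_iff.2 ((mem_nonunits_iff_dvd hP hX hπ hmem _).2 hdvd)⟩

theorem traceX_eq_sum (hfin : (H : Set (RatFunc K ≃ₐ[K] RatFunc K)).Finite) :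
    traceX H = ∑ τ ∈ hfin.toFinset, τ RatFunc.X :=
  finsum_mem_eq_finite_toFinset_sum (fun τ : RatFunc K ≃ₐ[K] RatFunc K => τ RatFunc.X) hfin

theorem apply_traceX (hfin : (H : Set (RatFunc K ≃ₐ[K] RatFunc K)).Finite)
    {τ : RatFunc K ≃ₐ[K] RatFunc K} (hτ : τ ∈ H) : τ (traceX H) = traceX H := by
  rw [traceX_eq_sum hfin, map_sum]
  refine Finset.sum_equiv (Equiv.mulLeft τ) (fun τ' => ?_) fun τ' _ => rfl
  simp only [Set.Finite.mem_toFinset, SetLike.mem_coe, Equiv.coe_mulLeft]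
  exact (Subgroup.mul_mem_cancel_left H hτ).symm

theorem traceX_mem_pullback (hfin : (H : Set (RatFunc K ≃ₐ[K] RatFunc K)).Finite)
    {τ : RatFunc K ≃ₐ[K] RatFunc K} (hτ : τ ∈ H) : traceX H ∈ pullback τ P ↔ traceX H ∈ P := by
  rw [mem_pullback, apply_traceX hfin hτ]

theorem hasValue_traceX_pullback (hfin : (H : Set (RatFunc K ≃ₐ[K] RatFunc K)).Finite)
    {τ : RatFunc K ≃ₐ[K] RatFunc K} (hτ : τ ∈ H) {c : K} :
    HasValue (pullback τ P) (traceX H) c ↔ HasValue P (traceX H) c := by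
  rw [hasValue_pullback, apply_traceX hfin hτ]

/-- A pole of the trace under `H` is a conjugate of the pole of `x`, hence also a pole of the trace
under any larger group. -/
theorem IsTraceData.subset (h : IsTraceData a b H O U d) (h' : IsTraceData a b H' O' U' d')
    (hle : H ≤ H') (hfin : (H' : Set (RatFunc K ≃ₐ[K] RatFunc K)).Finite) : O ⊆ O' := by
  intro α hα
  obtain ⟨P, hP, hv⟩ := exists_place α
  have h1 := h.notMem hP hv hα
  have hfinH : (H : Set (RatFunc K ≃ₐ[K] RatFunc K)).Finite := hfin.subset hle
  have h2 := traceX_eq_sum hfinH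
  obtain ⟨τ, hτ, hn⟩ : ∃ τ ∈ H, τ RatFunc.X ∉ P := by
    by_contra! hcon
    refine h1 (h2 ▸ sum_mem fun τ hτ => hcon τ ?_)
    simpa using hτ
  by_contra hα'
  refine h'.trace_notMem (pullback τ P) hP.pullback hn ?_
  rw [traceX_mem_pullback hfin (hle hτ)]
  exact (h'.mem_iff hP hv).2 hα'

theorem traceX_mem_fixedField (hfin : (H' : Set (RatFunc K ≃ₐ[K] RatFunc K)).Finite)
    (hle : H ≤ H') : traceX H' ∈ IntermediateField.fixedField H := by
  rw [IntermediateField.mem_fixedField_iff]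
  exact fun τ hτ => apply_traceX hfin (hle hτ)

/-- The values of the trace under `H` at the poles of the trace under `H'`, computed on the
projective line. -/
theorem mem_valuesAtPoles_iff (h : IsTraceData a b H O U d) (h' : IsTraceData a b H' O' U' d')
    (hle : H ≤ H') (hfin : (H' : Set (RatFunc K ≃ₐ[K] RatFunc K)).Finite) (c : K) :
    c ∈ valuesAtPoles (IntermediateField.fixedField H) (traceX H) (traceX H') ↔
      ∃ α ∈ O', α ∉ O ∧ U.eval α / (rootPoly O).eval α = c := by
  have hfinH : (H : Set (RatFunc K ≃ₐ[K] RatFunc K)).Finite := hfin.subset hle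
  constructor
  · rintro ⟨Q, hQ, ⟨t, ht, htQ⟩, s, hs, hsQ⟩
    obtain ⟨P, rfl⟩ := exists_comap_eq
      ((IntermediateField.fixedField H).val : IntermediateField.fixedField H →+* RatFunc K) Q
    rw [hasValue_comap] at hsQ
    change HasValue P (s : RatFunc K) c at hsQ
    rw [hs] at hsQ
    have htP : traceX H' ∉ P := by
      rw [← ht]
      exact htQ
    have hP : IsPlace K P :=
      ⟨fun c => hQ.1 c, fun hP => htP (by rw [hP]; exact ValuationSubring.mem_top _)⟩
    have hX : RatFunc.X ∈ P := by
      by_contra hX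
      exact h.trace_notMem P hP hX (hsQ.mem hP)
    obtain ⟨α, hα, hv⟩ := h'.exists_hasValue_X hP hX htP
    have hαO := (h.mem_iff hP hv).1 (hsQ.mem hP)
    exact ⟨α, hα, hαO, (h.hasValue hP hv hαO).unique hP hsQ⟩
  · rintro ⟨α, hα', hα, rfl⟩
    obtain ⟨P, hP, hv⟩ := exists_place α
    have hn := h'.notMem hP hv hα'
    refine ⟨P.comap ((IntermediateField.fixedField H).val : IntermediateField.fixedField H →+* RatFunc K),
      ⟨fun c => hP.1 c, fun htop => hn ?_⟩,
      ⟨⟨_, traceX_mem_fixedField hfin hle⟩, rfl, hn⟩,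
      ⟨_, traceX_mem_fixedField hfinH le_rfl⟩, rfl, ?_⟩
    · have : (⟨_, traceX_mem_fixedField hfin hle⟩ : IntermediateField.fixedField H) ∈
        P.comap ((IntermediateField.fixedField H).val : IntermediateField.fixedField H →+* RatFunc K) := by
          rw [htop]
          exact ValuationSubring.mem_top _
      exact this
    · rw [hasValue_comap]
      exact h.hasValue hP hv hα

theorem IsTraceData.monic_sub (h : IsTraceData a b H O U d) (c : K) :
    (U - C c * rootPoly O).Monic ∧ (U - C c * rootPoly O).natDegree = Nat.card H := by
  have hlt : (C c * rootPoly O).natDegree < U.natDegree := by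
    refine (natDegree_C_mul_le _ _).trans_lt ?_
    rw [natDegree_rootPoly, h.natDegree, ← h.card]
    exact Nat.lt_succ_self _
  refine ⟨h.monic.sub_of_left (degree_lt_degree hlt), ?_⟩
  rw [natDegree_sub_eq_left_of_natDegree_lt hlt, h.natDegree]

theorem IsTraceData.monic_prod (h : IsTraceData a b H O U d) (l : List K) :
    (l.map fun c => U - C c * rootPoly O).prod.Monic ∧
      (l.map fun c => U - C c * rootPoly O).prod.natDegree = l.length * Nat.card H := by
  induction l with
  | nil => simp
  | cons c l ih =>
    rw [List.map_cons, List.prod_cons]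
    refine ⟨(h.monic_sub c).1.mul ih.1, ?_⟩
    rw [(h.monic_sub c).1.natDegree_mul ih.1, (h.monic_sub c).2, ih.2, List.length_cons]
    ring

variable [Fintype K]

/-- A value of the smaller trace at a pole of the larger one is attained on a full `H`-orbit of such
poles, because `H` acts freely on them. -/
theorem card_le_card_fiber [DecidableEq K]
    (hm : IsPrimitiveOverFinite (X ^ 2 + C a * X + C b : K[X]))
    (hσ : σ RatFunc.X = 1 / (-RatFunc.C b * RatFunc.X - RatFunc.C a))
    (h : IsTraceData a b H O U d) (h' : IsTraceData a b H' O' U' d')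
    (hle : H ≤ H') (hH' : H' ≤ Subgroup.zpowers σ) {α : K} (hα : α ∈ O' \ O) :
    Nat.card H ≤ ((O' \ O).filter fun x => U.eval x / (rootPoly O).eval x =
      U.eval α / (rootPoly O).eval α).card := by
  have hfin := finite_of_le_zpowers hm hσ hH'
  have hfinH : (H : Set (RatFunc K ≃ₐ[K] RatFunc K)).Finite := hfin.subset hle
  obtain ⟨hα', hαO⟩ := Finset.mem_sdiff.1 hα
  obtain ⟨P, hP, hv⟩ := exists_place α
  have hrat := isRational_of_hasValue_X hP hv
  have hval := h.hasValue hP hv hαO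
  have hex : ∀ τ : RatFunc K ≃ₐ[K] RatFunc K, τ ∈ H →
      ∃ x : K, HasValue (pullback τ P) RatFunc.X x := by
    intro τ hτ
    refine hrat.pullback _ ?_
    by_contra hX
    refine h.trace_notMem _ hP.pullback hX ?_
    exact ((hasValue_traceX_pullback hfinH hτ).2 hval).mem hP.pullback
  choose! f hf using hex
  have hcard : hfinH.toFinset.card = Nat.card H := by
    rw [← Set.ncard_eq_toFinset_card _ hfinH]
    rfl
  rw [← hcard]
  refine Finset.card_le_card_of_injOn f (fun τ hτ => ?_) fun τ hτ τ' hτ' he => ?_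
  · have hτH : τ ∈ H := by simpa using hτ
    have h1 := (hasValue_traceX_pullback hfinH hτH).2 hval
    have hO : f τ ∉ O := (h.mem_iff hP.pullback (hf τ hτH)).1 (h1.mem hP.pullback)
    refine Finset.mem_coe.2 (Finset.mem_filter.2 ⟨Finset.mem_sdiff.2 ⟨?_, hO⟩,
      (h.hasValue hP.pullback (hf τ hτH) hO).unique hP.pullback h1⟩)
    by_contra hO'
    have h2 := (h'.mem_iff hP.pullback (hf τ hτH)).2 hO'
    rw [traceX_mem_pullback hfin (hle hτH)] at h2
    exact h'.notMem hP hv hα' h2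
  · have hτH : τ ∈ H := by simpa using hτ
    have hτH' : τ' ∈ H := by simpa using hτ'
    exact eq_of_pullback_eq hm hσ (hH' (hle hτH)) (hH' (hle hτH')) hP hrat
      (eq_of_hasValue_X hP.pullback hP.pullback (hf τ hτH) (he ▸ hf τ' hτH'))

/-- There are `p - 1` values of the smaller trace at the new poles, and these give the factorization
of the new denominator. That the old denominator times `∏ (U - λ D)` is divisible by the new one
bounds the number of values from below, the size of the fibres bounds it from above; then both sides
are monic of the same degree. -/
theorem length_and_rootPoly_eq (hm : IsPrimitiveOverFinite (X ^ 2 + C a * X + C b : K[X]))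
    (hσ : σ RatFunc.X = 1 / (-RatFunc.C b * RatFunc.X - RatFunc.C a))
    (h : IsTraceData a b H O U d) (h' : IsTraceData a b H' O' U' d')
    (hle : H ≤ H') (hH' : H' ≤ Subgroup.zpowers σ) {p : ℕ}
    (hcard : Nat.card H' = Nat.card H * p) {l : List K} (hl : l.Nodup)
    (hlmem : ∀ c, c ∈ l ↔
      c ∈ valuesAtPoles (IntermediateField.fixedField H) (traceX H) (traceX H')) :
    l.length + 1 = p ∧
      rootPoly O' = rootPoly O * (l.map fun c => U - C c * rootPoly O).prod := by
  classical
  have hfin := finite_of_le_zpowers hm hσ hH'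
  have hsub := h.subset h' hle hfin
  have hlf : l.toFinset = (O' \ O).image fun x => U.eval x / (rootPoly O).eval x := by
    ext c
    rw [List.mem_toFinset, hlmem, mem_valuesAtPoles_iff h h' hle hfin]
    simp [and_assoc]
  have hN := h.card
  have hN' := h'.card
  -- every value is attained on at least `|H|` of the new poles
  have hlen1 : l.length * Nat.card H + O.card ≤ O'.card := by
    have h1 : ((O' \ O).image fun x => U.eval x / (rootPoly O).eval x).card * Nat.card H ≤
        (O' \ O).card := by
      rw [Finset.card_eq_sum_card_image (fun x => U.eval x / (rootPoly O).eval x) (O' \ O),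
        ← smul_eq_mul]
      refine Finset.card_nsmul_le_sum _ _ _ fun c hc => ?_
      obtain ⟨α, hα, rfl⟩ := Finset.mem_image.1 hc
      exact card_le_card_fiber hm hσ h h' hle hH' hα
    rw [← hlf, List.toFinset_card_of_nodup hl, Finset.card_sdiff_of_subset hsub] at h1
    have := Finset.card_le_card hsub
    omega
  have hmon := (rootPoly_monic O).mul (h.monic_prod l).1
  have hdeg : (rootPoly O * (l.map fun c => U - C c * rootPoly O).prod).natDegree =
      O.card + l.length * Nat.card H := by
    rw [(rootPoly_monic O).natDegree_mul (h.monic_prod l).1, natDegree_rootPoly,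
      (h.monic_prod l).2]
  have hdvd : rootPoly O' ∣ rootPoly O * (l.map fun c => U - C c * rootPoly O).prod := by
    refine Finset.prod_dvd_of_coprime (fun x _ y _ hxy => ?_) fun α hα => ?_
    · exact isCoprime_X_sub_C_of_isUnit_sub (sub_ne_zero.2 hxy).isUnit
    · rw [dvd_iff_isRoot, IsRoot.def, eval_mul]
      by_cases hO : α ∈ O
      · rw [eval_rootPoly_eq_zero.2 hO, zero_mul]
      · have hD := mt eval_rootPoly_eq_zero.1 hO
        have hc : U.eval α / (rootPoly O).eval α ∈ l := by
          rw [← List.mem_toFinset, hlf]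
          exact Finset.mem_image_of_mem _ (Finset.mem_sdiff.2 ⟨hα, hO⟩)
        have hz : (U - C (U.eval α / (rootPoly O).eval α) * rootPoly O).eval α = 0 := by
          rw [eval_sub, eval_mul, eval_C, div_mul_cancel₀ _ hD, sub_self]
        obtain ⟨g, hg⟩ := List.dvd_prod (List.mem_map_of_mem
          (f := fun c => U - C c * rootPoly O) hc)
        rw [hg, eval_mul, hz, zero_mul, mul_zero]
  have hle2 := natDegree_le_of_dvd hdvd hmon.ne_zero
  rw [natDegree_rootPoly, hdeg] at hle2
  have hpos : 0 < Nat.card H := by omega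
  constructor
  · have h3 : Nat.card H * p = Nat.card H * (l.length + 1) := by
      rw [← hcard, mul_add, mul_one, mul_comm]
      omega
    exact (Nat.eq_of_mul_eq_mul_left hpos h3).symm
  · refine (eq_of_monic_of_dvd_of_natDegree_le (rootPoly_monic O') hmon hdvd ?_).symm
    rw [natDegree_rootPoly, hdeg]
    omega

end Step

/-! ### The basis polynomials -/

section Basis

variable {K : Type u} [Field K]

/-- The factor of a basis polynomial belonging to one level of the tower: the form
`∏_{k > e} (ξ - λₖ)` in `ξ = U / D`, made homogeneous of degree the length of `lam` and written in
`U` and `D`. -/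
noncomputable def levelPoly (U D : K[X]) (lam : List K) (e : ℕ) : K[X] :=
  D ^ e * ((lam.drop e).map fun c => U - C c * D).prod

theorem levelPoly_append_singleton {U D : K[X]} {lam : List K} {e : ℕ} (c : K)
    (he : e ≤ lam.length) :
    levelPoly U D (lam ++ [c]) e = levelPoly U D lam e * (U - C c * D) := by
  simp [levelPoly, List.drop_append_of_le_length he, mul_assoc]

theorem levelPoly_length (U D : K[X]) (lam : List K) :
    levelPoly U D lam lam.length = D ^ lam.length := by
  simp [levelPoly]

/-- The level factors are independent over polynomials of small degree: modulo the last `U - λ D`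
only the last term survives. -/
theorem levelPoly_independent {U D : K[X]} {N : ℕ} (hUD : IsCoprime U D)
    (hmon : ∀ c, (U - C c * D).Monic ∧ (U - C c * D).natDegree = N) (lam : List K)
    (f : ℕ → K[X]) (hf : ∀ e, (f e).degree < N)
    (hsum : ∑ e ∈ Finset.range (lam.length + 1), levelPoly U D lam e * f e = 0) :
    ∀ e ≤ lam.length, f e = 0 := by
  induction lam using List.reverseRecOn with
  | nil => simpa [levelPoly] using hsum
  | append_singleton lam c ih =>
    have h1 : ∑ e ∈ Finset.range (lam.length + 1), levelPoly U D (lam ++ [c]) e * f e =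
        (U - C c * D) * ∑ e ∈ Finset.range (lam.length + 1), levelPoly U D lam e * f e := by
      rw [Finset.mul_sum]
      refine Finset.sum_congr rfl fun e he => ?_
      rw [levelPoly_append_singleton c (by simpa [Nat.lt_succ_iff] using he)]
      ring
    have hlen : (lam ++ [c]).length = lam.length + 1 := by simp
    rw [hlen, Finset.sum_range_succ, h1, ← hlen, levelPoly_length] at hsum
    have hcop : IsCoprime (U - C c * D) D := by
      have := hUD.add_mul_right_left (-C c)
      rwa [neg_mul, ← sub_eq_add_neg] at this
    have hlast : f (lam ++ [c]).length = 0 := by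
      refine eq_zero_of_dvd_of_degree_lt (p := U - C c * D) ?_ ?_
      · refine (hcop.pow_right (n := (lam ++ [c]).length)).dvd_of_dvd_mul_left ?_
        rw [← dvd_add_right (Dvd.intro _ rfl), hsum]
        exact dvd_zero _
      · rw [degree_eq_natDegree (hmon c).1.ne_zero, (hmon c).2]
        exact hf _
    rw [hlast, mul_zero, add_zero] at hsum
    have h2 := ih (((mul_eq_zero.1 (hlen ▸ hsum))).resolve_left (hmon c).1.ne_zero)
    intro e he
    rcases Nat.lt_or_ge lam.length e with h | h
    · have : e = (lam ++ [c]).length := by omega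
      rw [this, hlast]
    · exact h2 e h

theorem natDegree_levelPoly_le {U D : K[X]} {N : ℕ} (hD : D.natDegree ≤ N)
    (hdeg : ∀ c, (U - C c * D).natDegree = N) (lam : List K) {e : ℕ} (he : e ≤ lam.length) :
    (levelPoly U D lam e).natDegree ≤ lam.length * N := by
  have h1 : ∀ l : List K, ((l.map fun c => U - C c * D).prod).natDegree ≤ l.length * N := by
    intro l
    induction l with
    | nil => simp
    | cons c l ih =>
      rw [List.map_cons, List.prod_cons, List.length_cons, add_mul, one_mul, add_comm]
      exact natDegree_mul_le.trans (add_le_add (hdeg c).le ih)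
  refine natDegree_mul_le.trans ((add_le_add (natDegree_pow_le_of_le e hD) (h1 _)).trans ?_)
  rw [List.length_drop, ← add_mul, Nat.add_sub_cancel' he]

/-- The value of a level factor is the level form at the point `(U : D)` of the projective line, up to
a scalar that does not depend on `e`. -/
theorem eval_levelPoly [DecidableEq K] (U D : K[X]) (lam : List K) {e : ℕ} (he : e ≤ lam.length)
    (x : K) : (levelPoly U D lam e).eval x =
      (if D.eval x = 0 then U.eval x else D.eval x) ^ lam.length *
        levelForm (if D.eval x = 0 then none else some (U.eval x / D.eval x)) lam e := by
  split_ifs with h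
  · rcases Nat.eq_zero_or_pos e with rfl | hpos
    · simp only [levelPoly, levelForm, pow_zero, one_mul, List.drop_zero, Option.elim_none, mul_one]
      clear he
      induction lam with
      | nil => simp
      | cons c l ih => simp [ih, h, pow_succ']
    · simp [levelPoly, levelForm, h, hpos.ne']
  · have h1 : ∀ l : List K, ((l.map fun c => U - C c * D).prod).eval x =
        D.eval x ^ l.length * (l.map fun c => U.eval x / D.eval x - c).prod := by
      intro l
      induction l with
      | nil => simp
      | cons c l ih =>
        rw [List.map_cons, List.prod_cons, eval_mul, ih, List.map_cons, List.prod_cons]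
        simp only [eval_sub, eval_mul, eval_C, List.length_cons, pow_succ]
        field_simp
    rw [levelPoly, eval_mul, h1, eval_pow, List.length_drop, ← mul_assoc, ← pow_add,
      Nat.add_sub_cancel' he]
    rfl

/-- The level degrees `(pᵢ - 1) Nᵢ = Nᵢ₊₁ - Nᵢ` telescope. -/
theorem natDegree_prod_levelPoly_lt {r : ℕ} : ∀ (p : Fin r → ℕ) (U D : ℕ → K[X]) (N : ℕ → ℕ)
    (lam : Fin r → List K) (_ : ∀ i, (lam i).length + 1 = p i)
    (_ : ∀ i : Fin r, N (i + 1) = N i * p i) (_ : N 0 = 1)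
    (_ : ∀ i : Fin r, (D i).natDegree ≤ N i)
    (_ : ∀ (i : Fin r) (c : K), (U i - C c * D i).natDegree = N i) (e : ∀ i, Fin (p i)),
    (∏ i : Fin r, levelPoly (U i) (D i) (lam i) (e i)).natDegree < N r := by
  induction r with
  | zero =>
    intro p U D N lam hlam hN hN0 hD hdeg e
    simp [hN0]
  | succ r ih =>
    intro p U D N lam hlam hN hN0 hD hdeg e
    have h1 := ih (fun i => p i.castSucc) U D N (fun i => lam i.castSucc) (fun i => hlam _)
      (fun i => by simpa using hN i.castSucc) hN0 (fun i => by simpa using hD i.castSucc)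
      (fun i => by simpa using hdeg i.castSucc) (fun i => e i.castSucc)
    have h2 := natDegree_levelPoly_le (hD (Fin.last r)) (hdeg (Fin.last r)) (lam (Fin.last r))
      (e := e (Fin.last r)) (by have := hlam (Fin.last r); have := (e (Fin.last r)).2; omega)
    have h3 : N (r + 1) = (lam (Fin.last r)).length * N r + N r := by
      rw [show N (r + 1) = N r * p (Fin.last r) from hN (Fin.last r), ← hlam (Fin.last r)]
      ring
    rw [Fin.prod_univ_castSucc]
    simp only [Fin.val_castSucc, Fin.val_last] at *
    refine natDegree_mul_le.trans_lt ?_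
    omega

/-- Independence of the products, split off at the top level: the coefficients of the top factors are
combinations of products of the lower levels, hence of degree less than `Nᵣ`. -/
theorem prod_levelPoly_independent {r : ℕ} : ∀ (p : Fin r → ℕ) (U D : ℕ → K[X]) (N : ℕ → ℕ)
    (lam : Fin r → List K) (_ : ∀ i, (lam i).length + 1 = p i)
    (_ : ∀ i : Fin r, N (i + 1) = N i * p i) (_ : N 0 = 1)
    (_ : ∀ i : Fin r, (D i).natDegree ≤ N i)
    (_ : ∀ (i : Fin r) (c : K), (U i - C c * D i).Monic ∧ (U i - C c * D i).natDegree = N i)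
    (_ : ∀ i : Fin r, IsCoprime (U i) (D i)) (a : (∀ i, Fin (p i)) → K)
    (_ : ∑ e, C (a e) * ∏ i : Fin r, levelPoly (U i) (D i) (lam i) (e i) = 0), ∀ e, a e = 0 := by
  induction r with
  | zero =>
    intro p U D N lam hlam hN hN0 hD hdeg hcop a ha e
    simpa [Subsingleton.elim e default] using ha
  | succ r ih =>
    intro p U D N lam hlam hN hN0 hD hdeg hcop a ha
    -- the coefficient of the `e₁`-th factor of the top level
    let f (e₁ : Fin (p (Fin.last r))) : K[X] := ∑ e : ∀ i : Fin r, Fin (p i.castSucc),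
      C (a (Fin.snoc e e₁)) * ∏ i : Fin r, levelPoly (U i) (D i) (lam i.castSucc) (e i)
    let f' (k : ℕ) : K[X] := if h : k < p (Fin.last r) then f ⟨k, h⟩ else 0
    have hNpos : 0 < N r :=
      (Nat.zero_le _).trans_lt (natDegree_prod_levelPoly_lt (fun i : Fin r => p i.castSucc) U D N
        (fun i => lam i.castSucc) (fun i => hlam _)
        (fun i => by simpa using hN i.castSucc) hN0 (fun i => by simpa using hD i.castSucc)
        (fun i c => by simpa using (hdeg i.castSucc c).2)
        (fun i => ⟨0, by have := hlam i.castSucc; omega⟩))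
    have hfdeg : ∀ k, (f' k).degree < N r := by
      intro k
      simp only [f']
      split_ifs with h
      · refine (degree_sum_le _ _).trans_lt ((Finset.sup_lt_iff (WithBot.bot_lt_coe _)).2
          fun e _ => ?_)
        refine degree_le_natDegree.trans_lt ?_
        rw [Nat.cast_lt]
        refine (natDegree_C_mul_le _ _).trans_lt ?_
        exact natDegree_prod_levelPoly_lt (fun i : Fin r => p i.castSucc) U D N
          (fun i => lam i.castSucc) (fun i => hlam _)
          (fun i => by simpa using hN i.castSucc) hN0 (fun i => by simpa using hD i.castSucc)
          (fun i c => by simpa using (hdeg i.castSucc c).2) e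
      · rw [degree_zero]
        exact WithBot.bot_lt_coe _
    have hsum : ∑ k ∈ Finset.range ((lam (Fin.last r)).length + 1),
        levelPoly (U r) (D r) (lam (Fin.last r)) k * f' k = 0 := by
      rw [← ha, ← Equiv.sum_comp (Fin.snocEquiv fun i => Fin (p i)), Fintype.sum_prod_type,
        hlam (Fin.last r), Finset.sum_range]
      refine Finset.sum_congr rfl fun e₁ _ => ?_
      simp only [f', f, e₁.2, dite_true, Fin.eta, Finset.mul_sum]
      refine Finset.sum_congr rfl fun e _ => ?_
      have hs : (Fin.snocEquiv fun i => Fin (p i)) (e₁, e) = Fin.snoc e e₁ := rfl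
      rw [hs, Fin.prod_univ_castSucc]
      simp only [Fin.snoc_castSucc, Fin.snoc_last, Fin.val_castSucc,
        Fin.val_last]
      ring
    have h1 := levelPoly_independent (hcop (Fin.last r)) (hdeg (Fin.last r)) (lam (Fin.last r)) f'
      hfdeg hsum
    intro e
    have h2 : f (e (Fin.last r)) = 0 := by
      have h3 := h1 (e (Fin.last r)) (by
        have := hlam (Fin.last r); have := (e (Fin.last r)).2; omega)
      simpa [f'] using h3
    have h4 := ih (fun i => p i.castSucc) U D N (fun i => lam i.castSucc) (fun i => hlam _)
      (fun i => by simpa using hN i.castSucc) hN0 (fun i => by simpa using hD i.castSucc)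
      (fun i => by simpa using hdeg i.castSucc) (fun i => by simpa using hcop i.castSucc)
      (fun e' => a (Fin.snoc e' (e (Fin.last r)))) h2 (fun i => e i.castSucc)
    have h5 : (Fin.snoc (fun i => e (Fin.castSucc i)) (e (Fin.last r)) :
        ∀ i : Fin (r + 1), Fin (p i)) = e := Fin.snoc_init_self e
    rwa [h5] at h4

theorem finrank_degreeLT (n : ℕ) : Module.finrank K (degreeLT K n) = n := by
  rw [(degreeLTEquiv K n).finrank_eq, Module.finrank_fin_fun]

theorem IsTraceData.isCoprime {a b : K} {H : Subgroup (RatFunc K ≃ₐ[K] RatFunc K)} {O : Finset K}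
    {U : K[X]} {d : K} (h : IsTraceData a b H O U d) : IsCoprime U (rootPoly O) := by
  refine IsCoprime.prod_right fun α hα => IsCoprime.symm ?_
  rw [(irreducible_X_sub_C α).coprime_iff_not_dvd, dvd_iff_isRoot]
  exact h.eval_ne_zero α hα

end Basis

/-! ### The chain of subgroups -/

section Chain

theorem chainOrder_zero {r : ℕ} (p : Fin r → ℕ) : chainOrder p 0 = 1 := by
  simp [chainOrder]

theorem chainOrder_succ {r : ℕ} (p : Fin r → ℕ) (i : Fin r) :
    chainOrder p (i + 1) = chainOrder p i * p i := by
  have h : ∀ j : Fin r, (if (j : ℕ) < i + 1 then p j else 1) =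
      (if (j : ℕ) < i then p j else 1) * (if j = i then p j else 1) := by
    intro j
    rcases lt_trichotomy (j : ℕ) i with h | h | h
    · simp [h, Nat.lt_succ_of_lt h, Fin.ne_of_lt h]
    · simp [Fin.ext h]
    · have h1 : ¬ (j : ℕ) < i + 1 := by omega
      have h2 : ¬ (j : ℕ) < i := by omega
      simp [h1, h2, (Fin.ne_of_gt h)]
  simp only [chainOrder, h, Finset.prod_mul_distrib]
  simp

theorem chainOrder_length {r : ℕ} (p : Fin r → ℕ) : chainOrder p r = ∏ i, p i := by
  simp [chainOrder]

theorem chainOrder_dvd {r : ℕ} (p : Fin r → ℕ) {i j : ℕ} (h : i ≤ j) :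
    chainOrder p i ∣ chainOrder p j := by
  refine Finset.prod_dvd_prod_of_dvd _ _ fun k _ => ?_
  by_cases h1 : (k : ℕ) < i
  · simp [h1, h1.trans_le h]
  · simp [h1]

theorem chainOrder_dvd_prod {r : ℕ} (p : Fin r → ℕ) (i : ℕ) : chainOrder p i ∣ ∏ j, p j := by
  refine Finset.prod_dvd_prod_of_dvd _ _ fun k _ => ?_
  by_cases h1 : (k : ℕ) < i
  · simp [h1]
  · simp [h1]

variable {K : Type u} [Field K] [Fintype K] {a b : K} {σ : RatFunc K ≃ₐ[K] RatFunc K}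

theorem subgroupOfOrder_le_zpowers (N : ℕ) : subgroupOfOrder σ N ≤ Subgroup.zpowers σ := by
  rw [subgroupOfOrder, Subgroup.zpowers_le]
  exact Subgroup.npow_mem_zpowers σ _

theorem subgroupOfOrder_mono {N N' : ℕ} (h : N ∣ N') (h' : N' ∣ Fintype.card K + 1) :
    subgroupOfOrder σ N ≤ subgroupOfOrder σ N' := by
  rw [subgroupOfOrder, Subgroup.zpowers_le]
  obtain ⟨k, rfl⟩ := h
  obtain ⟨m, hm⟩ := h'
  have hpos : 0 < N * k * m := hm ▸ Nat.succ_pos _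
  have hNk : 0 < N * k := Nat.pos_of_mul_pos_right hpos
  have h1 : (Fintype.card K + 1) / N = (Fintype.card K + 1) / (N * k) * k := by
    rw [hm, Nat.mul_div_cancel_left _ hNk, mul_assoc,
      Nat.mul_div_cancel_left _ (Nat.pos_of_mul_pos_right hNk), mul_comm]
  rw [h1, pow_mul]
  exact Subgroup.npow_mem_zpowers _ _

theorem card_subgroupOfOrder (hm : IsPrimitiveOverFinite (X ^ 2 + C a * X + C b : K[X]))
    (hσ : σ RatFunc.X = 1 / (-RatFunc.C b * RatFunc.X - RatFunc.C a)) {N : ℕ}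
    (hN : N ∣ Fintype.card K + 1) : Nat.card (subgroupOfOrder σ N) = N := by
  rw [subgroupOfOrder, Nat.card_zpowers, orderOf_pow_of_dvd, orderOf_sigma hm hσ,
    Nat.div_div_self hN (Nat.succ_ne_zero _)]
  · exact (Nat.div_pos (Nat.le_of_dvd (Nat.succ_pos _) hN)
      (Nat.pos_of_dvd_of_pos hN (Nat.succ_pos _))).ne'
  · rw [orderOf_sigma hm hσ]
    exact Nat.div_dvd_of_dvd hN

theorem card_dvd_of_le_zpowers (hm : IsPrimitiveOverFinite (X ^ 2 + C a * X + C b : K[X]))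
    (hσ : σ RatFunc.X = 1 / (-RatFunc.C b * RatFunc.X - RatFunc.C a))
    {G : Subgroup (RatFunc K ≃ₐ[K] RatFunc K)} (hG : G ≤ Subgroup.zpowers σ) :
    Nat.card G ∣ Fintype.card K + 1 := by
  rw [← orderOf_sigma hm hσ, ← Nat.card_zpowers]
  exact Subgroup.card_dvd_of_le hG

/-- A cyclic group has only one subgroup of each order. -/
theorem eq_subgroupOfOrder (hm : IsPrimitiveOverFinite (X ^ 2 + C a * X + C b : K[X]))
    (hσ : σ RatFunc.X = 1 / (-RatFunc.C b * RatFunc.X - RatFunc.C a))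
    {G : Subgroup (RatFunc K ≃ₐ[K] RatFunc K)} (hG : G ≤ Subgroup.zpowers σ) :
    G = subgroupOfOrder σ (Nat.card G) := by
  have hdvd := card_dvd_of_le_zpowers hm hσ hG
  have hcard := card_subgroupOfOrder hm hσ hdvd
  have hpos : 0 < Nat.card G := Nat.pos_of_dvd_of_pos hdvd (Nat.succ_pos _)
  have hfin : Finite (subgroupOfOrder σ (Nat.card G)) :=
    Nat.finite_of_card_ne_zero (by rw [hcard]; exact hpos.ne')
  refine Subgroup.eq_of_le_of_card_ge (fun τ hτ => ?_) hcard.le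
  obtain ⟨k, rfl⟩ := exists_pow_eq hm hσ (hG hτ)
  have h1 : σ ^ (k * Nat.card G) = 1 := by
    rw [pow_mul]
    exact congrArg Subtype.val (pow_card_eq_one' (x := (⟨σ ^ k, hτ⟩ : G)))
  rw [← orderOf_dvd_iff_pow_eq_one, orderOf_sigma hm hσ] at h1
  obtain ⟨m, hm'⟩ := hdvd
  rw [subgroupOfOrder, hm', Nat.mul_div_cancel_left _ hpos]
  rw [hm', mul_comm k] at h1
  obtain ⟨j, rfl⟩ := Nat.dvd_of_mul_dvd_mul_left hpos h1
  rw [pow_mul]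
  exact Subgroup.npow_mem_zpowers _ _

end Chain

/-! ### Orbits of places -/

section Orbit

variable {K : Type u} [Field K] {G : Subgroup (RatFunc K ≃ₐ[K] RatFunc K)}
  {𝔓 : ValuationSubring (IntermediateField.fixedField G)}

theorem pullback_mem_rationalPlacesOver {τ : RatFunc K ≃ₐ[K] RatFunc K} (hτ : τ ∈ G)
    {P : ValuationSubring (RatFunc K)} (hP : P ∈ rationalPlacesOver 𝔓) :
    pullback τ P ∈ rationalPlacesOver 𝔓 := by
  obtain ⟨h1, h2, h3⟩ := hP
  refine ⟨h1.pullback, h2.pullback, ?_⟩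
  rw [LiesOver, ← h3]
  ext y
  have : τ (y : RatFunc K) = y := (IntermediateField.mem_fixedField_iff G _).1 y.2 τ hτ
  change τ (y : RatFunc K) ∈ P ↔ (y : RatFunc K) ∈ P
  rw [this]

theorem finrank_fixedField (hfin : (G : Set (RatFunc K ≃ₐ[K] RatFunc K)).Finite) :
    Module.finrank (IntermediateField.fixedField G) (RatFunc K) = Nat.card G := by
  have : Fintype G := hfin.fintype
  rw [Nat.card_eq_fintype_card]
  exact FixedPoints.finrank_eq_card G (RatFunc K)

variable [Fintype K] {a b : K} {σ : RatFunc K ≃ₐ[K] RatFunc K}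

/-- A completely split rational place has a rational place above it. If the trace has a finite value
`c` there, the places above it are `|G|` distinct zeros of the polynomial `U - c D` of degree
`|G|`. -/
theorem exists_mem_rationalPlacesOver
    (hm : IsPrimitiveOverFinite (X ^ 2 + C a * X + C b : K[X]))
    (hσ : σ RatFunc.X = 1 / (-RatFunc.C b * RatFunc.X - RatFunc.C a))
    (hG : G ≤ Subgroup.zpowers σ) (hrat : IsRational K 𝔓)
    (hcard : {P : ValuationSubring (RatFunc K) | IsPlace K P ∧ LiesOver P 𝔓}.ncard = Nat.card G) :
    (rationalPlacesOver 𝔓).Nonempty := by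
  obtain ⟨O, U, d, h⟩ := exists_isTraceData hm hσ hG
  have hfin := finite_of_le_zpowers hm hσ hG
  have hpos : 0 < Nat.card G := by
    rw [← h.card]
    exact Nat.succ_pos _
  have hSfin := Set.finite_of_ncard_pos (hcard ▸ hpos)
  have hSne : {P : ValuationSubring (RatFunc K) | IsPlace K P ∧ LiesOver P 𝔓}.Nonempty :=
    (Set.ncard_pos hSfin).1 (hcard ▸ hpos)
  let t : IntermediateField.fixedField G := ⟨traceX G, traceX_mem_fixedField hfin le_rfl⟩
  by_cases ht : t ∈ 𝔓
  · obtain ⟨c, hc⟩ := hrat t ht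
    have hval : ∀ P, IsPlace K P → LiesOver P 𝔓 → HasValue P (traceX G) c := by
      rintro P hP rfl
      exact (hasValue_comap (IntermediateField.fixedField G).val).1 hc
    obtain ⟨P, hP, α, hα⟩ := exists_hasValue_X_of_card hSfin.toFinset (W := U - C c * rootPoly O)
      (h.monic_sub c).1.ne_zero (fun P hP => by
        obtain ⟨hP, hPl⟩ := hSfin.mem_toFinset.1 hP
        have hv := hval P hP hPl
        have hX : RatFunc.X ∈ P := by
          by_contra hX
          exact h.trace_notMem P hP hX (hv.mem hP)
        refine ⟨hP, hX, ?_⟩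
        have h1 := mul_mem_nonunits (algebraMap_mem hP hX (rootPoly O)) hv
        rw [h.trace_eq, mul_sub,
          mul_div_cancel₀ _ (algebraMap_ne_zero (rootPoly_monic O).ne_zero)] at h1
        rwa [map_sub, map_mul, RatFunc.algebraMap_C, ← RatFunc.algebraMap_eq_C,
          mul_comm (algebraMap K (RatFunc K) c)])
      (by rw [(h.monic_sub c).2, ← hcard, Set.ncard_eq_toFinset_card _ hSfin])
      (hSfin.toFinset_nonempty.2 hSne)
    obtain ⟨hP, hPl⟩ := hSfin.mem_toFinset.1 hP
    exact ⟨P, hP, isRational_of_hasValue_X hP hα, hPl⟩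
  · obtain ⟨P, hP, hPl⟩ := hSne
    refine ⟨P, hP, ?_, hPl⟩
    by_cases hX : RatFunc.X ∈ P
    · have hn : traceX G ∉ P := by
        intro hmem
        refine ht ?_
        rw [← (show P.comap _ = 𝔓 from hPl)]
        exact hmem
      obtain ⟨α, -, hα⟩ := h.exists_hasValue_X hP hX hn
      exact isRational_of_hasValue_X hP hα
    · exact isRational_of_X_notMem hm hσ hP hX

/-- The rational places above a completely split rational place form one free orbit. -/
theorem ncard_rationalPlacesOver (hm : IsPrimitiveOverFinite (X ^ 2 + C a * X + C b : K[X]))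
    (hσ : σ RatFunc.X = 1 / (-RatFunc.C b * RatFunc.X - RatFunc.C a))
    (hG : G ≤ Subgroup.zpowers σ) (hrat : IsRational K 𝔓) (hsplit : SplitsCompletely 𝔓) :
    (rationalPlacesOver 𝔓).ncard = Nat.card G ∧
      ∃ P₀ ∈ rationalPlacesOver 𝔓, ∀ P ∈ rationalPlacesOver 𝔓, ∃ j < Nat.card G,
        P = pullback ((σ ^ ((Fintype.card K + 1) / Nat.card G)) ^ j) P₀ := by
  have hfin := finite_of_le_zpowers hm hσ hG
  have hcard : {P : ValuationSubring (RatFunc K) | IsPlace K P ∧ LiesOver P 𝔓}.ncard =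
      Nat.card G := hsplit.trans (finrank_fixedField hfin)
  obtain ⟨P₀, hP₀⟩ := exists_mem_rationalPlacesOver hm hσ hG hrat hcard
  have hpos : 0 < Nat.card G :=
    Nat.pos_of_dvd_of_pos (card_dvd_of_le_zpowers hm hσ hG) (Nat.succ_pos _)
  have hSfin := Set.finite_of_ncard_pos (hcard ▸ hpos)
  have hGeq := eq_subgroupOfOrder hm hσ hG
  set g := σ ^ ((Fintype.card K + 1) / Nat.card G) with hg
  have hGz : G = Subgroup.zpowers g := hGeq
  have hord : orderOf g = Nat.card G := by
    rw [← Nat.card_zpowers, ← hGz]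
  have hgG : ∀ j : ℕ, g ^ j ∈ G := fun j => by
    rw [hGz]
    exact Subgroup.npow_mem_zpowers _ _
  have hsub : rationalPlacesOver 𝔓 ⊆
      {P : ValuationSubring (RatFunc K) | IsPlace K P ∧ LiesOver P 𝔓} :=
    fun P hP => ⟨hP.1, hP.2.2⟩
  have hRfin := hSfin.subset hsub
  let f (j : ℕ) : ValuationSubring (RatFunc K) := pullback (g ^ j) P₀
  have hinj : Set.InjOn f (Finset.range (Nat.card G)) := by
    intro i hi j hj hij
    have h1 := eq_of_pullback_eq hm hσ (hG (hgG i)) (hG (hgG j)) hP₀.1 hP₀.2.1 hij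
    refine pow_injOn_Iio_orderOf ?_ ?_ h1
    · simpa [hord] using hi
    · simpa [hord] using hj
  have himg : f '' (Finset.range (Nat.card G)) ⊆ rationalPlacesOver 𝔓 := by
    rintro _ ⟨j, -, rfl⟩
    exact pullback_mem_rationalPlacesOver (hgG j) hP₀
  have hncard : (f '' (Finset.range (Nat.card G))).ncard = Nat.card G := by
    rw [hinj.ncard_image, Set.ncard_coe_finset, Finset.card_range]
  have hle := Set.ncard_le_ncard hsub hSfin
  have hge := Set.ncard_le_ncard himg hRfin
  rw [hcard] at hle
  rw [hncard] at hge
  have hR : (rationalPlacesOver 𝔓).ncard = Nat.card G := le_antisymm hle hge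
  refine ⟨hR, P₀, hP₀, fun P hP => ?_⟩
  have heq := Set.eq_of_subset_of_ncard_le himg (by rw [hncard, hR]) hRfin
  rw [← heq] at hP
  obtain ⟨j, hj, rfl⟩ := hP
  exact ⟨j, by simpa using hj, rfl⟩

end Orbit

/-! ### Values on the projective line -/

open Classical in
/-- The value of `y` at `P` in the projective line over `K`: `none` if there is no value in `K`. -/
noncomputable def valueAt {K : Type u} [Field K] (P : ValuationSubring (RatFunc K))
    (y : RatFunc K) : Option K :=
  if h : ∃ c : K, HasValue P y c then some h.choose else none

theorem valueAt_eq_some {K : Type u} [Field K] {P : ValuationSubring (RatFunc K)}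
    (hP : IsPlace K P) {y : RatFunc K} {c : K} (h : HasValue P y c) : valueAt P y = some c := by
  have h1 : ∃ c : K, HasValue P y c := ⟨c, h⟩
  rw [valueAt, dif_pos h1, h1.choose_spec.unique hP h]

theorem valueAt_eq_none {K : Type u} [Field K] {P : ValuationSubring (RatFunc K)}
    (hP : IsPlace K P) {y : RatFunc K} (h : y ∉ P) : valueAt P y = none :=
  dif_neg fun ⟨_, hc⟩ => h (hc.mem hP)

theorem valueAt_congr {K : Type u} [Field K] {P P' : ValuationSubring (RatFunc K)}
    {y : RatFunc K} (h : ∀ c : K, HasValue P y c ↔ HasValue P' y c) :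
    valueAt P y = valueAt P' y := by
  have h1 : HasValue P y = HasValue P' y := funext fun c => propext (h c)
  classical
  exact congrArg (fun q : K → Prop => if h : ∃ c, q c then some h.choose else none) h1

theorem IsTraceData.valueAt_eq {K : Type u} [Field K] [DecidableEq K] {a b : K}
    {H : Subgroup (RatFunc K ≃ₐ[K] RatFunc K)} {O : Finset K} {U : K[X]} {d : K}
    (h : IsTraceData a b H O U d) {P : ValuationSubring (RatFunc K)} (hP : IsPlace K P) {α : K}
    (hα : HasValue P RatFunc.X α) :
    valueAt P (traceX H) = if (rootPoly O).eval α = 0 then none else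
      some (U.eval α / (rootPoly O).eval α) := by
  split_ifs with hz
  · exact valueAt_eq_none hP (h.notMem hP hα (eval_rootPoly_eq_zero.1 hz))
  · exact valueAt_eq_some hP (h.hasValue hP hα (mt eval_rootPoly_eq_zero.2 hz))

/-! ### The basis in polynomial form -/

section Formula

variable {K : Type u} [Field K]

theorem list_prod_sub_mul (y D : RatFunc K) (hD : D ≠ 0) (t : List K) :
    (t.map fun c => y / D - RatFunc.C c).prod * D ^ t.length =
      (t.map fun c => y - RatFunc.C c * D).prod := by
  induction t with
  | nil => simp
  | cons c t ih =>
    rw [List.map_cons, List.prod_cons, List.map_cons, List.prod_cons, ← ih, List.length_cons,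
      pow_succ]
    field_simp

variable {r : ℕ} {l : Fin r → List K} {O : ℕ → Finset K} {U : ℕ → K[X]}

/-- The denominator of the last trace is the product of the new factors of all levels. -/
theorem rootPoly_eq_prod (hO : O 0 = ∅)
    (hstep : ∀ i : Fin r, rootPoly (O (i + 1)) =
      rootPoly (O i) * ((l i).map fun c => U i - C c * rootPoly (O i)).prod) :
    rootPoly (O r) = ∏ i : Fin r, ((l i).map fun c => U i - C c * rootPoly (O i)).prod := by
  let W (i : ℕ) : K[X] :=
    if h : i < r then ((l ⟨i, h⟩).map fun c => U i - C c * rootPoly (O i)).prod else 1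
  have h : ∀ k ≤ r, rootPoly (O k) = ∏ i ∈ Finset.range k, W i := by
    intro k
    induction k with
    | zero => intro _; rw [hO, Finset.range_zero, Finset.prod_empty, rootPoly, Finset.prod_empty]
    | succ k ih =>
      intro hk
      have h2 : W k = ((l ⟨k, hk⟩).map fun c => U k - C c * rootPoly (O k)).prod :=
        dif_pos (Nat.lt_of_succ_le hk)
      rw [Finset.prod_range_succ, ← ih (Nat.le_of_succ_le hk), h2]
      exact hstep ⟨k, hk⟩
  rw [h r le_rfl, Finset.prod_range]
  exact Finset.prod_congr rfl fun i _ => dif_pos i.2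

variable [Fintype K] {a b : K} {σ : RatFunc K ≃ₐ[K] RatFunc K} {p : Fin r → ℕ} {d : ℕ → K}

theorem algebraMap_prod_mul_zElt
    (hdata : ∀ i, IsTraceData a b (chainGroup σ p i) (O i) (U i) (d i)) (i : Fin r) {e : ℕ}
    (he : e ≤ (l i).length) :
    algebraMap K[X] (RatFunc K) ((l i).map fun c => U i - C c * rootPoly (O i)).prod *
      zElt σ p l i e = algebraMap K[X] (RatFunc K) (levelPoly (U i) (rootPoly (O i)) (l i) e) := by
  have hD := algebraMap_ne_zero (rootPoly_monic (O i)).ne_zero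
  have hmap : ∀ t : List K,
      algebraMap K[X] (RatFunc K) (t.map fun c => U i - C c * rootPoly (O i)).prod =
        (t.map fun c => algebraMap K[X] (RatFunc K) (U i) -
          RatFunc.C c * algebraMap K[X] (RatFunc K) (rootPoly (O i))).prod := by
    intro t
    rw [map_list_prod, List.map_map]
    congr 1
    refine List.map_congr_left fun c _ => ?_
    simp only [Function.comp_apply, map_sub, map_mul, RatFunc.algebraMap_C]
  have hne := algebraMap_ne_zero ((hdata i).monic_prod ((l i).take e)).1.ne_zero
  have hx : chainX σ p i = algebraMap K[X] (RatFunc K) (U i) /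
      algebraMap K[X] (RatFunc K) (rootPoly (O i)) := (hdata i).trace_eq
  have hz := list_prod_sub_mul (algebraMap K[X] (RatFunc K) (U i)) _ hD ((l i).take e)
  rw [← hmap, ← hx, List.length_take_of_le he] at hz
  have hsplit : ((l i).map fun c => U i - C c * rootPoly (O i)).prod =
      (((l i).take e).map fun c => U i - C c * rootPoly (O i)).prod *
        (((l i).drop e).map fun c => U i - C c * rootPoly (O i)).prod := by
    rw [← List.prod_append, ← List.map_append, List.take_append_drop]
  rw [hsplit, levelPoly, zElt, map_mul, map_mul, map_pow, ← hz]
  rw [← hz] at hne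
  have hne2 := left_ne_zero_of_mul hne
  field_simp

/-- Each element of the family `Q ^ n / u · tildeB` is a product of one form for each level. -/
theorem quadQ_pow_div_mul_tildeB
    (hdata : ∀ i, IsTraceData a b (chainGroup σ p i) (O i) (U i) (d i)) (hO : O 0 = ∅)
    (hlen : ∀ i, (l i).length + 1 = p i)
    (hstep : ∀ i : Fin r, rootPoly (O (i + 1)) =
      rootPoly (O i) * ((l i).map fun c => U i - C c * rootPoly (O i)).prod)
    (e : ∀ i, Fin (p i)) :
    quadQ a b ^ Nat.card (chainGroup σ p r) / numeratorU (chainGroup σ p r) *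
      tildeB a b σ (chainGroup σ p r) p l e =
    algebraMap K[X] (RatFunc K)
      (C (d r) * ∏ i : Fin r, levelPoly (U i) (rootPoly (O i)) (l i) (e i)) := by
  have hQ := pow_ne_zero (Nat.card (chainGroup σ p r)) (quadQ_ne_zero a b)
  have hU := algebraMap_ne_zero (hdata r).monic.ne_zero
  have hD := algebraMap_ne_zero (rootPoly_monic (O r)).ne_zero
  have hprod : algebraMap K[X] (RatFunc K) (rootPoly (O r)) * ∏ i, zElt σ p l i (e i) =
      algebraMap K[X] (RatFunc K)
        (∏ i : Fin r, levelPoly (U i) (rootPoly (O i)) (l i) (e i)) := by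
    rw [rootPoly_eq_prod hO hstep, map_prod, map_prod, ← Finset.prod_mul_distrib]
    refine Finset.prod_congr rfl fun i _ => algebraMap_prod_mul_zElt hdata i ?_
    have := hlen i
    have := (e i).2
    omega
  rw [(hdata r).numeratorU_eq, tildeB, (hdata r).trace_eq, (hdata r).norm_eq, map_mul, ← hprod,
    RatFunc.algebraMap_C]
  field_simp

end Formula

/-! ### Numerical estimates -/

theorem sum_add_one_le_two_mul_prod {r : ℕ} (p : Fin r → ℕ) (hp : ∀ i, 2 ≤ p i) :
    ∑ i, p i + 1 ≤ 2 * ∏ i, p i := by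
  induction r with
  | zero => simp
  | succ r ih =>
    rw [Fin.sum_univ_succ, Fin.prod_univ_succ]
    have h1 := ih (fun i => p i.succ) fun i => hp _
    have h2 := hp 0
    have h3 : 0 < ∏ i : Fin r, p i.succ :=
      Finset.prod_pos fun i _ => Nat.pos_of_ne_zero (by have := hp i.succ; omega)
    nlinarith

theorem two_pow_le_chainOrder {r : ℕ} (p : Fin r → ℕ) (hp : ∀ i, 2 ≤ p i) {i : ℕ} (hi : i ≤ r) :
    2 ^ i ≤ chainOrder p i := by
  induction i with
  | zero => simp [chainOrder_zero]
  | succ i ih =>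
    have h1 : chainOrder p (i + 1) = chainOrder p i * p ⟨i, hi⟩ := chainOrder_succ p ⟨i, hi⟩
    rw [h1, pow_succ]
    exact Nat.mul_le_mul (ih (Nat.le_of_succ_le hi)) (hp _)

theorem sum_div_chainOrder_le {r : ℕ} (p : Fin r → ℕ) (hp : ∀ i, 2 ≤ p i) (n : ℕ) :
    ∑ i : Fin r, n / chainOrder p i ≤ 2 * n := by
  have h1 : ∑ i : Fin r, n / chainOrder p i ≤ ∑ i ∈ Finset.range r, n / 2 ^ i := by
    rw [← Fin.sum_univ_eq_sum_range fun i => n / 2 ^ i]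
    exact Finset.sum_le_sum fun i _ =>
      Nat.div_le_div_left (two_pow_le_chainOrder p hp i.2.le) (by positivity)
  refine h1.trans ((Nat.geom_sum_le le_rfl n r).trans ?_)
  simp [mul_comm]

/-- The number of factors `r` is at most `log₂ n`, and the sum of the factors at most `r B`. -/
theorem cost_le {r n : ℕ} {B : ℝ} (p : Fin r → ℕ) (hp : ∀ i, 2 ≤ p i) (hB : ∀ i, (p i : ℝ) ≤ B)
    (hprod : ∏ i, p i = n) (hr : 0 < r) :
    ((3 * n * ∑ i, p i + n : ℕ) : ℝ) ≤ 8 * (B * n * Real.log n) := by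
  have h2n : 2 ^ r ≤ n := by
    rw [← hprod, ← chainOrder_length]
    exact two_pow_le_chainOrder p hp le_rfl
  have hlog : (r : ℝ) ≤ 2 * Real.log n := by
    have h1 : Real.log ((2 : ℝ) ^ r) ≤ Real.log n :=
      Real.log_le_log (by positivity) (by exact_mod_cast h2n)
    rw [Real.log_pow] at h1
    have h2 := Real.log_two_gt_d9
    have h3 : (0 : ℝ) ≤ r := Nat.cast_nonneg r
    nlinarith
  have hB2 : 2 ≤ B := le_trans (by exact_mod_cast hp ⟨0, hr⟩) (hB ⟨0, hr⟩)
  have hsum : (∑ i, p i : ℝ) ≤ r * B := by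
    simpa using Finset.sum_le_card_nsmul Finset.univ (fun i => (p i : ℝ)) B fun i _ => hB i
  have hr1 : (1 : ℝ) ≤ r := by exact_mod_cast hr
  have hn0 : (0 : ℝ) ≤ n := Nat.cast_nonneg n
  push_cast
  have h4 : (1 : ℝ) ≤ r * B := by nlinarith
  have h5 : (r : ℝ) * B ≤ 2 * Real.log n * B := mul_le_mul_of_nonneg_right hlog (by linarith)
  calc 3 * (n : ℝ) * ∑ i, (p i : ℝ) + n ≤ 3 * n * (r * B) + n * (r * B) := by
        refine add_le_add (mul_le_mul_of_nonneg_left hsum (by positivity)) ?_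
        nlinarith
    _ = 4 * n * (r * B) := by ring
    _ ≤ 4 * n * (2 * Real.log n * B) := mul_le_mul_of_nonneg_left h5 (by positivity)
    _ = 8 * (B * n * Real.log n) := by ring

end GFFT

open GFFT in
theorem theorem4 :
    ∃ C : ℝ, ∀ (K : Type*) [Field K] [Fintype K] (a b : K)
      (_ : GFFT.IsPrimitiveOverFinite (X ^ 2 + Polynomial.C a * X + Polynomial.C b : K[X]))
      (σ : RatFunc K ≃ₐ[K] RatFunc K)
      (_ : σ RatFunc.X = 1 / (-RatFunc.C b * RatFunc.X - RatFunc.C a))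
      (G : Subgroup (RatFunc K ≃ₐ[K] RatFunc K)) (_ : G ≤ Subgroup.zpowers σ)
      (n r : ℕ) (_ : Nat.card G = n)
      (B : ℝ) (p : Fin r → ℕ) (_ : ∀ i, 2 ≤ p i) (_ : ∀ i, (p i : ℝ) ≤ B) (_ : ∏ i, p i = n)
      (l : Fin r → List K) (_ : GFFT.IsPoleEnumeration σ p l)
      (𝔓 : ValuationSubring (IntermediateField.fixedField G))
      (_ : GFFT.IsPlace K 𝔓) (_ : GFFT.IsRational K 𝔓) (_ : GFFT.SplitsCompletely 𝔓)
      (_ : GFFT.HasPole 𝔓 (GFFT.traceX G) ↔ n = Fintype.card K + 1),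
      (GFFT.rationalPlacesOver 𝔓).ncard = n ∧
      ∃ (𝓑 : Module.Basis (∀ i : Fin r, Fin (p i)) K (Polynomial.degreeLT K n))
        (A : GFFT.Program K (∀ i : Fin r, Fin (p i))
          {P : ValuationSubring (RatFunc K) //
            P ∈ GFFT.rationalPlacesOver 𝔓 ∧ RatFunc.X ∈ P}),
        (∀ e, algebraMap K[X] (RatFunc K) (𝓑 e) =
          GFFT.quadQ a b ^ n / GFFT.numeratorU G * GFFT.tildeB a b σ G p l e) ∧
        (∀ (f : Polynomial.degreeLT K n) P,
          GFFT.HasValue P.1 (algebraMap K[X] (RatFunc K) f) (A.eval (fun e => 𝓑.repr f e) P)) ∧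
        (A.numOps : ℝ) ≤ C * (B * n * Real.log n) ∧
        (A.storage : ℝ) ≤ C * n := by
  classical
  refine ⟨8, ?_⟩
  intro K _ _ a b hm σ hσ G hG n r hn B p hp hB hprod l hl 𝔓 _ hrat hsplit _
  -- the chain of groups
  have hndvd : n ∣ Fintype.card K + 1 := hn ▸ card_dvd_of_le_zpowers hm hσ hG
  have hnpos : 0 < n := Nat.pos_of_dvd_of_pos hndvd (Nat.succ_pos _)
  have hchain : ∀ i, chainOrder p i ∣ n := fun i => hprod ▸ chainOrder_dvd_prod p i
  have hcardH : ∀ i, Nat.card (chainGroup σ p i) = chainOrder p i := fun i =>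
    card_subgroupOfOrder hm hσ ((hchain i).trans hndvd)
  have hleσ : ∀ i, chainGroup σ p i ≤ Subgroup.zpowers σ := fun i => subgroupOfOrder_le_zpowers _
  have hGr : G = chainGroup σ p r := by
    rw [chainGroup, chainOrder_length, hprod, ← hn]
    exact eq_subgroupOfOrder hm hσ hG
  choose O U d hdata using fun i => exists_isTraceData hm hσ (hleσ i)
  have hO0 : O 0 = ∅ := by
    have h1 := (hdata 0).card
    rw [hcardH, chainOrder_zero] at h1
    exact Finset.card_eq_zero.1 (by omega)
  have hstep : ∀ i : Fin r, (l i).length + 1 = p i ∧ rootPoly (O (i + 1)) =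
      rootPoly (O i) * ((l i).map fun c => U i - Polynomial.C c * rootPoly (O i)).prod := fun i =>
    length_and_rootPoly_eq hm hσ (hdata i) (hdata (i + 1))
      (subgroupOfOrder_mono (chainOrder_dvd p (Nat.le_succ _)) ((hchain _).trans hndvd))
      (hleσ _) (by rw [hcardH, hcardH, chainOrder_succ]) (hl i).1 (hl i).2
  have hlen := fun i => (hstep i).1
  -- the basis
  let v (e : ∀ i, Fin (p i)) : K[X] :=
    Polynomial.C (d r) * ∏ i : Fin r, levelPoly (U i) (rootPoly (O i)) (l i) (e i)
  have hv : ∀ e, algebraMap K[X] (RatFunc K) (v e) =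
      quadQ a b ^ n / numeratorU G * tildeB a b σ G p l e := by
    intro e
    rw [← hn, hGr]
    exact (quadQ_pow_div_mul_tildeB hdata hO0 hlen (fun i => (hstep i).2) e).symm
  have hNr : chainOrder p r = n := by rw [chainOrder_length, hprod]
  have hDdeg : ∀ i : Fin r, (rootPoly (O i)).natDegree ≤ chainOrder p i := fun i => by
    rw [natDegree_rootPoly, ← hcardH, ← (hdata i).card]
    exact Nat.le_succ _
  have hmon : ∀ (i : Fin r) (c : K), (U i - Polynomial.C c * rootPoly (O i)).Monic ∧
      (U i - Polynomial.C c * rootPoly (O i)).natDegree = chainOrder p i := fun i c => by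
    rw [← hcardH]
    exact (hdata i).monic_sub c
  have hvdeg : ∀ e, v e ∈ degreeLT K n := by
    intro e
    rw [mem_degreeLT]
    refine degree_le_natDegree.trans_lt ?_
    rw [Nat.cast_lt, ← hNr]
    exact (natDegree_C_mul_le _ _).trans_lt (natDegree_prod_levelPoly_lt p U
      (fun i => rootPoly (O i)) (chainOrder p) l hlen (chainOrder_succ p) (chainOrder_zero p)
      hDdeg (fun i c => (hmon i c).2) e)
  let v' (e : ∀ i, Fin (p i)) : degreeLT K n := ⟨v e, hvdeg e⟩
  have hli : LinearIndependent K v' := by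
    rw [Fintype.linearIndependent_iff]
    intro g hg
    have h1 : ∑ e, g e • v e = 0 := by
      have := congrArg (degreeLT K n).subtype hg
      simpa [v'] using this
    refine prod_levelPoly_independent p U (fun i => rootPoly (O i)) (chainOrder p) l hlen
      (chainOrder_succ p) (chainOrder_zero p) hDdeg hmon (fun i => (hdata i).isCoprime) g ?_
    refine ((mul_eq_zero (a := Polynomial.C (d r))).1 ?_).resolve_left
      (by simpa using (hdata r).d_ne_zero)
    rw [← h1, Finset.mul_sum]
    refine Finset.sum_congr rfl fun e _ => ?_
    rw [smul_eq_C_mul, mul_left_comm]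
  have : Nonempty (∀ i, Fin (p i)) := ⟨fun i => ⟨0, by have := hp i; omega⟩⟩
  let 𝓑 : Module.Basis (∀ i : Fin r, Fin (p i)) K (degreeLT K n) :=
    basisOfLinearIndependentOfCardEqFinrank hli (by
      rw [finrank_degreeLT, Fintype.card_pi]
      simpa using hprod)
  have h𝓑 : ∀ e, ((𝓑 e : degreeLT K n) : K[X]) = v e := fun e => by
    simp [𝓑, v']
  -- the points
  obtain ⟨hncard, P₀, hP₀, hP₀j⟩ := ncard_rationalPlacesOver hm hσ hG hrat hsplit
  rw [hn] at hncard hP₀j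
  refine ⟨hncard, ?_⟩
  set g := σ ^ ((Fintype.card K + 1) / n) with hg
  let ξ (i : Fin r) (j : ℕ) : Option K := valueAt (pullback (g ^ j) P₀) (chainX σ p i)
  have hξ : ∀ (i : Fin r) (j : ℕ), ξ i (j % (n / chainOrder p i)) = ξ i j := by
    intro i j
    have hfin := finite_of_le_zpowers hm hσ (hleσ i)
    -- the generator of `Gᵢ` is `g` to the power `n / |Gᵢ|`
    have hgM : g ^ (n / chainOrder p i) ∈ chainGroup σ p i := by
      rw [chainGroup, subgroupOfOrder, hg, ← pow_mul,
        Nat.div_mul_div_comm hndvd (hchain i), mul_comm n, Nat.mul_div_mul_right _ _ hnpos]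
      exact Subgroup.mem_zpowers _
    refine valueAt_congr fun c => ?_
    conv_rhs => rw [← Nat.mod_add_div j (n / chainOrder p i), pow_add, pow_mul, pullback_mul]
    exact (hasValue_traceX_pullback hfin (pow_mem hgM _)).symm
  choose idx hidx hidxP using fun o : {P : ValuationSubring (RatFunc K) //
    P ∈ rationalPlacesOver 𝔓 ∧ RatFunc.X ∈ P} => hP₀j o.1 o.2.1
  -- the scalar by which the value of a basis polynomial at a point differs from the product of
  -- the level forms
  let scal (x : K) : K := d r * ∏ i : Fin r, (if (rootPoly (O i)).eval x = 0 then (U i).eval x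
    else (rootPoly (O i)).eval x) ^ (l i).length
  let sc (j : ℕ) : K := scal ((valueAt (pullback (g ^ j) P₀) RatFunc.X).getD 0)
  have hvalue : ∀ (f : degreeLT K n) (o : {P : ValuationSubring (RatFunc K) //
      P ∈ rationalPlacesOver 𝔓 ∧ RatFunc.X ∈ P}),
      HasValue o.1 (algebraMap K[X] (RatFunc K) f)
        ((∑ e, 𝓑.repr f e * ∏ i, levelForm (ξ i (idx o)) (l i) (e i)) * sc (idx o)) := by
    intro f o
    have hP := o.2.1.1
    obtain ⟨x, hx⟩ := o.2.1.2.1 _ o.2.2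
    have h1 := hx.polynomial hP (f : K[X])
    have h2 : (f : K[X]) = ∑ e, 𝓑.repr f e • v e := by
      have := congrArg (degreeLT K n).subtype (𝓑.sum_repr f)
      rw [map_sum] at this
      simp only [map_smul, Submodule.subtype_apply, h𝓑] at this
      exact this.symm
    have h3 : sc (idx o) = scal x := by
      simp only [sc, ← hidxP, valueAt_eq_some hP hx, Option.getD_some]
    have h4 : ∀ i, ξ i (idx o) = if (rootPoly (O i)).eval x = 0 then none else
        some ((U i).eval x / (rootPoly (O i)).eval x) := fun i => by
      simp only [ξ, ← hidxP]
      exact (hdata i).valueAt_eq hP hx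
    convert h1 using 1
    rw [h2, eval_finsetSum, Finset.sum_mul, h3]
    refine Finset.sum_congr rfl fun e _ => ?_
    rw [eval_smul, smul_eq_mul, mul_assoc]
    congr 1
    simp only [v, eval_mul, eval_C, eval_prod, scal]
    rw [mul_left_comm, ← Finset.prod_mul_distrib]
    congr 1
    refine Finset.prod_congr rfl fun i _ => ?_
    rw [eval_levelPoly _ _ _ (by have := hlen i; have := (e i).2; omega), ← h4, mul_comm]
  -- the program
  suffices hprog : ∃ A : Program K (∀ i : Fin r, Fin (p i)) {P : ValuationSubring (RatFunc K) //
      P ∈ rationalPlacesOver 𝔓 ∧ RatFunc.X ∈ P},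
      (A.numOps : ℝ) ≤ 8 * (B * n * Real.log n) ∧ (A.storage : ℝ) ≤ 8 * n ∧
      ∀ c o, A.eval c o =
        (∑ e, c e * ∏ i, levelForm (ξ i (idx o)) (l i) (e i)) * sc (idx o) by
    obtain ⟨A, h1, h2, h3⟩ := hprog
    refine ⟨𝓑, A, fun e => ?_, fun f o => ?_, h1, h2⟩
    · rw [h𝓑, hv]
    · rw [h3]
      exact hvalue f o
  rcases Nat.eq_zero_or_pos r with rfl | hr
  -- For `n = 1` the bound allows no operation; the scalar is `1` then.
  · have hn1 : n = 1 := by simpa using hprod.symm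
    have hd : d 0 = 1 := (hdata 0).d_eq_one (by rw [hcardH, chainOrder_zero])
    refine ⟨⟨0, Fin.elim0, .output fun _ => .inl default⟩, ?_, ?_, fun c o => ?_⟩
    · simp [Program.numOps, Code.numOps, hn1]
    · simp
    · simp [Program.eval, Code.eval, sc, scal, hd]
  · obtain ⟨A, h1, h2, h3⟩ := exists_fft_program p (fun k => n / chainOrder p k) ξ l hlen
      (fun i => by
        rw [chainOrder_succ]
        have h5 := hchain (i + 1)
        rw [chainOrder_succ] at h5
        obtain ⟨m, hm'⟩ := h5
        have hpos : 0 < chainOrder p i * p i * m := hm' ▸ hnpos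
        have hc : 0 < chainOrder p i * p i := Nat.pos_of_mul_pos_right hpos
        rw [hm', Nat.mul_div_cancel_left _ hc, mul_assoc,
          Nat.mul_div_cancel_left _ (Nat.pos_of_mul_pos_right hc)])
      (by rw [hNr, Nat.div_self hnpos]) hξ sc idx
      (by simpa [chainOrder_zero] using hidx)
    simp only [chainOrder_zero, Nat.div_one] at h1 h2
    refine ⟨A, ?_, ?_, h3⟩
    · exact (Nat.cast_le.2 h1).trans (cost_le p hp hB hprod hr)
    · have h5 := sum_div_chainOrder_le p hp n
      have h6 := sum_add_one_le_two_mul_prod p hp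
      rw [hprod] at h6
      have h7 : A.storage ≤ 8 * n := by omega
      exact_mod_cast h7
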